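/- All monoids are commutative. A *pomonoid* is a monoid with a compatible partial order in which every element is $\ge 0$. In a poset, $x\ll y$ means: whenever an increasing sequence $(z_n)_{n\in\mathbb N}$ has a supremum that is $\ge y$, some $z_k\ge x$. A *Cuntz semigroup* is a pomonoid such that (O1) increasing sequences have suprema; (O2) every element is the supremum of a $\ll$-increasing sequence; (O3) $x'\ll x$ and $y'\ll y$ imply $x'+y'\ll x+y$; (O4) $\sup_n (x_n+y_n)=\sup_n x_n+\sup_n y_n$ for increasing sequences $(x_n)$, $(y_n)$. Let $\mathcal C$ be one of the categories $\mathrm{PoS}$ (posets and order-preserving maps), $\mathrm{PoM}$ (pomonoids and order-preserving monoid homomorphisms), $\mathrm{Cu}$ (Cuntz semigroups and order-preserving monoid homomorphisms that preserve $\ll$ and suprema of increasing sequences). The objects of $\mathcal C_{*\mathrm{Gp}}$ are the pairs $(S,G)$ of an object $S$ of $\mathcal C$ and a functor $G$ from the poset $S$ (viewed as a category) to the category $\mathrm{AbGp}$ of abelian groups, where for $\mathcal C=\mathrm{PoM},\mathrm{Cu}$ the group $G(0)$ is required to be trivial, and for $\mathcal C=\mathrm{Cu}$ also that $G$ preserve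 inductive limits of sequences: $G(\sup_n x_n)=\varinjlim_n G(x_n)$ for every increasing sequence $(x_n)$. A morphism $(S,G)\to(T,H)$ is a pair $(\alpha,\eta)$ of a $\mathcal C$-morphism $\alpha:S\to T$ and a natural transformation $\eta:G\Rightarrow H\circ\alpha$; the composition is $(\beta,\nu)\circ(\alpha,\eta)=(\beta\circ\alpha,\nu_\alpha\circ\eta)$ with $(\nu_\alpha)_s=\nu_{\alpha(s)}$. Let $((S_i,G_i),(\alpha_{ij},\eta_{ij}))_{i\in I}$ be an inductive system in $\mathcal C_{*\mathrm{Gp}}$ indexed by a (non-empty, upward) directed set $I$, and let $(S_\infty,\alpha_{i\infty})_i$ be an inductive limit of $(S_i,\alpha_{ij})_i$ in $\mathcal C$. A *limit functor* with *limit transformations* is a functor $G_\infty:S_\infty\to\mathrm{AbGp}$ with natural transformations $\eta_{i\infty}:G_i\Rightarrow G_\infty\circ\alpha_{i\infty}$ such that $(\eta_{j\infty})_{\alpha_{ij}(s)}\circ(\eta_{ij})_s=(\eta_{i\infty})_s$ for $i\le j$, $s\in S_i$, and: 1. for all $i\in I$ and $s\in S_i$, the group $G_\infty(\alpha_{i\infty}(s))$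 with the maps $(\eta_{j\infty})_{\alpha_{ij}(s)}$, $j\ge i$, is the inductive limit of the system $\big(G_j(\alpha_{ij}(s)),(\eta_{jk})_{\alpha_{ij}(s)}\big)_{j\ge i}$; 2. if $\mathcal C=\mathrm{Cu}$ (completion): whenever $s\in S_\infty$ is the supremum of a $\ll$-increasing sequence $(x_n)$ in $\bigcup_i\alpha_{i\infty}(S_i)$, the group $G_\infty(s)$ with the maps $G_\infty(x_n\le s)$ is the inductive limit of the groups $G_\infty(x_n)$. **Theorem.** For $\mathcal C=\mathrm{PoS},\mathrm{PoM},\mathrm{Cu}$, the categories $\mathcal C$ and $\mathcal C_{*\mathrm{Gp}}$ have all inductive limits over directed sets. More precisely, for every inductive system in $\mathcal C_{*\mathrm{Gp}}$ and every inductive limit $(S_\infty,\alpha_{i\infty})_i$ of the underlying system in $\mathcal C$, a limit functor $G_\infty$ with limit transformations $\eta_{i\infty}$ exists; and for every such choice, $(S_\infty,G_\infty)$ is an object of $\mathcal C_{*\mathrm{Gp}}$ and $$\big((S_\infty,G_\infty),(\alpha_{i\infty},\eta_{i\infty})\big)_{i\in I}$$ is an inductive limit of $((S_i,G_i),(\alpha_{ij},\eta_{ij}))_{i\in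 I}$ in $\mathcal C_{*\mathrm{Gp}}$. -/

import Mathlib

open CategoryTheory CategoryTheory.Limits

universe u v

/-! ### Pomonoids and the category `PoM` -/

/-- A positively ordered (commutative) monoid. -/
structure PoM : Type (u + 1) where
  carrier : Type u
  [addCommMonoid : AddCommMonoid carrier]
  [partialOrder : PartialOrder carrier]
  [isOrderedAddMonoid : IsOrderedAddMonoid carrier]
  zero_le : ∀ x : carrier, 0 ≤ x

attribute [instance] PoM.addCommMonoid PoM.partialOrder PoM.isOrderedAddMonoid

namespace PoM

instance : CoeSort PoM.{u} (Type u) := ⟨PoM.carrier⟩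

/-- Morphisms of pomonoids are the order-preserving monoid homomorphisms. -/
instance : Category PoM.{u} where
  Hom S T := S →+o T
  id S := OrderAddMonoidHom.id S
  comp f g := OrderAddMonoidHom.comp g f

/-- The functor that forgets the addition. -/
def toPartOrd : PoM.{u} ⥤ PartOrd.{u} where
  obj S := PartOrd.of S
  map f := PartOrd.ofHom (OrderHomClass.toOrderHom (show _ →+o _ from f))

end PoM

/-! ### Abstract Cuntz semigroups and the category `Cu` -/

/-- The (sequential) way-below relation `x ≪ y`: whenever an increasing sequence has a supremum
that dominates `y`, one of its terms dominates `x`. -/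
def WayBelow {S : Type u} [PartialOrder S] (x y : S) : Prop :=
  ∀ z : ℕ → S, Monotone z → ∀ s : S, IsLUB (Set.range z) s → y ≤ s → ∃ k, x ≤ z k

/-- Abstract Cuntz semigroups: pomonoids that satisfy the axioms (O1) to (O4). -/
structure CuSemigroup : Type (u + 1) extends PoM.{u} where
  /-- (O1) increasing sequences have suprema. -/
  exists_isLUB : ∀ x : ℕ → carrier, Monotone x → ∃ s, IsLUB (Set.range x) s
  /-- (O2) every element is the supremum of a `≪`-increasing sequence. -/
  exists_wayBelow_seq : ∀ s : carrier,
    ∃ x : ℕ → carrier, (∀ n, WayBelow (x n) (x (n + 1))) ∧ IsLUB (Set.range x) s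
  /-- (O3) addition and the way-below relation are compatible. -/
  wayBelow_add : ∀ {x' x y' y : carrier},
    WayBelow x' x → WayBelow y' y → WayBelow (x' + y') (x + y)
  /-- (O4) addition and suprema of increasing sequences are compatible. -/
  isLUB_add : ∀ (x y : ℕ → carrier) (s t : carrier), Monotone x → Monotone y →
    IsLUB (Set.range x) s → IsLUB (Set.range y) t →
      IsLUB (Set.range fun n => x n + y n) (s + t)

namespace CuSemigroup

instance : CoeSort CuSemigroup.{u} (Type u) := ⟨fun S => S.carrier⟩

/-- `Cu`-morphisms: order-preserving monoid homomorphisms that preserve the way-below relation and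
the suprema of increasing sequences. -/
@[ext]
structure Hom (S T : CuSemigroup.{u}) where
  toHom : S →+o T
  map_wayBelow : ∀ {x y : S}, WayBelow x y → WayBelow (toHom x) (toHom y)
  map_isLUB : ∀ (x : ℕ → S) (s : S), Monotone x → IsLUB (Set.range x) s →
    IsLUB (Set.range fun n => toHom (x n)) (toHom s)

instance : Category CuSemigroup.{u} where
  Hom S T := Hom S T
  id S :=
    { toHom := OrderAddMonoidHom.id S
      map_wayBelow := fun h => h
      map_isLUB := fun _ _ _ h => h }
  comp f g :=
    { toHom := g.toHom.comp f.toHom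
      map_wayBelow := fun h => g.map_wayBelow (f.map_wayBelow h)
      map_isLUB := fun x s hx h =>
        g.map_isLUB _ _ (fun _ _ hab => OrderHomClass.mono f.toHom (hx hab))
          (f.map_isLUB x s hx h) }

/-- The functor that forgets the addition. -/
def toPartOrd : CuSemigroup.{u} ⥤ PartOrd.{u} where
  obj S := PartOrd.of S
  map f := PartOrd.ofHom (OrderHomClass.toOrderHom (Hom.toHom f))

end CuSemigroup

/-! ### Group systems

`U : C ⥤ PartOrd` is the forgetful functor of the base category `C` (one of `PoS`, `PoM`, `Cu`), and
`P S G` is the extra condition that the base category puts on a functor `G` from (the poset of) `S`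
to abelian groups. A poset is viewed as a category in the usual way. -/

/-- The homomorphism `G (s ≤ t) : G s ⟶ G t`. If `s = t`, it is the identity (up to this
equality). -/
def atLE {S : Type u} [Preorder S] (G : S ⥤ AddCommGrpCat.{u}) {s t : S} (h : s ≤ t) :
    G.obj s ⟶ G.obj t :=
  G.map (homOfLE h)

theorem atLE_refl {S : Type u} [Preorder S] (G : S ⥤ AddCommGrpCat.{u}) {s : S} (h : s ≤ s) :
    atLE G h = 𝟙 (G.obj s) :=
  G.map_id s

theorem atLE_trans {S : Type u} [Preorder S] (G : S ⥤ AddCommGrpCat.{u}) {r s t : S}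
    (h : r ≤ s) (h' : s ≤ t) : atLE G h ≫ atLE G h' = atLE G (h.trans h') :=
  (G.map_comp _ _).symm

theorem atLE_trans_assoc {S : Type u} [Preorder S] (G : S ⥤ AddCommGrpCat.{u}) {r s t : S}
    (h : r ≤ s) (h' : s ≤ t) {A : AddCommGrpCat.{u}} (f : G.obj t ⟶ A) :
    atLE G h ≫ atLE G h' ≫ f = atLE G (h.trans h') ≫ f := by
  rw [← Category.assoc, atLE_trans]

section GroupSystems

variable {C : Type v} [Category.{u} C]

/-- The value `α (s)` of a morphism `α` of the base category. -/
def app (U : C ⥤ PartOrd.{u}) {S T : C} (α : S ⟶ T) (s : U.obj S) : U.obj T :=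
  (U.map α).hom s

section app

variable (U : C ⥤ PartOrd.{u})

theorem app_mono {S T : C} (α : S ⟶ T) {s t : U.obj S} (h : s ≤ t) : app U α s ≤ app U α t :=
  (U.map α).hom.monotone h

theorem app_id {S : C} (s : U.obj S) : app U (𝟙 S) s = s := by
  simp [app]

theorem app_comp {S T V : C} (α : S ⟶ T) (β : T ⟶ V) (s : U.obj S) :
    app U (α ≫ β) s = app U β (app U α s) := by
  simp [app]

end app

/-- A group system `(S, G)`: an object `S` of the base category and a functor `G` from the poset `S`
to abelian groups (with the extra condition `P`). -/
structure GroupSystem (U : C ⥤ PartOrd.{u})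
    (P : ∀ S : C, (U.obj S ⥤ AddCommGrpCat.{u}) → Prop) where
  base : C
  fib : U.obj base ⥤ AddCommGrpCat.{u}
  property : P base fib

namespace GroupSystem

variable {U : C ⥤ PartOrd.{u}} {P : ∀ S : C, (U.obj S ⥤ AddCommGrpCat.{u}) → Prop}

/-- A morphism `(α, η) : (S, G) ⟶ (T, H)`: a morphism `α : S ⟶ T` of the base category together with
a natural transformation `η : G ⟶ H ∘ α`, with components `η_s : G (s) ⟶ H (α (s))`. -/
structure Hom (X Y : GroupSystem U P) where
  base : X.base ⟶ Y.base
  trans (s : U.obj X.base) : X.fib.obj s ⟶ Y.fib.obj (app U base s)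
  naturality {s t : U.obj X.base} (h : s ≤ t) :
    atLE X.fib h ≫ trans t = trans s ≫ atLE Y.fib (app_mono U base h)

theorem Hom.ext' {X Y : GroupSystem U P} {f g : Hom X Y} (h : f.base = g.base)
    (h' : ∀ s (e : app U f.base s ≤ app U g.base s), f.trans s ≫ atLE Y.fib e = g.trans s) :
    f = g := by
  obtain ⟨f, η, hη⟩ := f
  obtain ⟨g, ν, hν⟩ := g
  obtain rfl : f = g := h
  congr 1
  funext s
  have := h' s le_rfl
  rwa [atLE_refl, Category.comp_id] at this

/-- The composition is `(β, ν) ∘ (α, η) = (β ∘ α, ν_α ∘ η)`. The last factor of `trans s` is the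
identity of the group at `β (α (s)) = (β ∘ α) (s)`, and similarly for the identity morphisms. -/
instance : Category (GroupSystem U P) where
  Hom X Y := Hom X Y
  id X :=
    { base := 𝟙 X.base
      trans := fun s => atLE X.fib (app_id U s).ge
      naturality := fun h => by rw [atLE_trans, atLE_trans] }
  comp {X Y Z} f g :=
    { base := f.base ≫ g.base
      trans := fun s => f.trans s ≫ g.trans (app U f.base s) ≫
        atLE Z.fib (app_comp U f.base g.base s).ge
      naturality := fun h => by
        rw [reassoc_of% f.naturality, reassoc_of% g.naturality]
        simp only [Category.assoc, atLE_trans] }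
  id_comp {X Y} f := by
    refine Hom.ext' (Category.id_comp _) fun s e => ?_
    simp only [Category.assoc, atLE_trans]
    rw [reassoc_of% f.naturality, atLE_trans, atLE_refl, Category.comp_id]
  comp_id {X Y} f := by
    refine Hom.ext' (Category.comp_id _) fun s e => ?_
    simp only [Category.assoc, atLE_trans]
    rw [atLE_refl, Category.comp_id]
  assoc {W X Y Z} f g h := by
    refine Hom.ext' (Category.assoc _ _ _) fun s e => ?_
    simp only [Category.assoc, atLE_trans]
    rw [reassoc_of% h.naturality]
    simp only [atLE_trans]

/-- The functor `(S, G) ↦ S` to the base category. -/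
def toBase (U : C ⥤ PartOrd.{u}) (P : ∀ S : C, (U.obj S ⥤ AddCommGrpCat.{u}) → Prop) :
    GroupSystem U P ⥤ C where
  obj X := X.base
  map f := Hom.base f

theorem trans_of_eq_id {X : GroupSystem U P} {f : X ⟶ X} (h : f = 𝟙 X) (s : U.obj X.base)
    (e : app U f.base s ≤ s) : f.trans s ≫ atLE X.fib e = 𝟙 (X.fib.obj s) := by
  subst h
  exact (atLE_trans X.fib (app_id U s).ge e).trans (atLE_refl X.fib _)

theorem trans_of_comp_eq {X Y Z : GroupSystem U P} {f : X ⟶ Y} {g : Y ⟶ Z} {k : X ⟶ Z}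
    (h : f ≫ g = k) (s : U.obj X.base)
    (e : app U g.base (app U f.base s) ≤ app U k.base s) :
    f.trans s ≫ g.trans (app U f.base s) ≫ atLE Z.fib e = k.trans s := by
  subst h
  rfl

theorem comp_eq_of {X Y Z : GroupSystem U P} {f : X ⟶ Y} {g : Y ⟶ Z} {k : X ⟶ Z}
    (h : f.base ≫ g.base = k.base)
    (h' : ∀ s (e : app U g.base (app U f.base s) ≤ app U k.base s),
      f.trans s ≫ g.trans (app U f.base s) ≫ atLE Z.fib e = k.trans s) : f ≫ g = k := by
  refine Hom.ext' h fun s e => Eq.trans ?_ (h' s ((app_comp U _ _ s).ge.trans e))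
  change (f.trans s ≫ g.trans (app U f.base s) ≫ atLE Z.fib _) ≫ atLE Z.fib _ = _
  simp only [Category.assoc, atLE_trans]

/-! ### Limit functors and limit transformations

Let `F` be an inductive system of group systems, with members `(S_i, G_i)` and connecting maps
`(α_ij, η_ij)`, and let `d` be a cocone `(S_∞, α_i∞)` on the inductive system `(S_i, α_ij)`. -/

variable {J : Type u} [Preorder J] (F : J ⥤ GroupSystem U P)

/-- The element `α_ij (s)` of `S_j`. -/
def push {i j : J} (h : i ≤ j) (s : U.obj (F.obj i).base) : U.obj (F.obj j).base :=
  app U (F.map (homOfLE h)).base s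

/-- The map `(η_ij)_s : G_i (s) ⟶ G_j (α_ij (s))`. -/
def pushMap {i j : J} (h : i ≤ j) (s : U.obj (F.obj i).base) :
    (F.obj i).fib.obj s ⟶ (F.obj j).fib.obj (push F h s) :=
  (F.map (homOfLE h)).trans s

theorem push_refl {i : J} (h : i ≤ i) (s : U.obj (F.obj i).base) : push F h s = s :=
  (congrArg (fun f : F.obj i ⟶ F.obj i => app U f.base s) (F.map_id i)).trans (app_id U s)

theorem push_push {i j k : J} (h : i ≤ j) (h' : j ≤ k) (s : U.obj (F.obj i).base) :
    push F h' (push F h s) = push F (h.trans h') s :=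
  (app_comp U _ _ s).symm.trans
    (congrArg (fun f : F.obj i ⟶ F.obj k => app U f.base s)
      (F.map_comp (homOfLE h) (homOfLE h')).symm)

theorem pushMap_refl {i : J} (h : i ≤ i) (s : U.obj (F.obj i).base) :
    pushMap F h s ≫ atLE (F.obj i).fib (push_refl F h s).le = 𝟙 _ :=
  trans_of_eq_id (F.map_id i) s _

theorem pushMap_pushMap {i j k : J} (h : i ≤ j) (h' : j ≤ k) (s : U.obj (F.obj i).base) :
    pushMap F h s ≫ pushMap F h' (push F h s) ≫ atLE (F.obj k).fib (push_push F h h' s).le =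
      pushMap F (h.trans h') s :=
  trans_of_comp_eq (F.map_comp (homOfLE h) (homOfLE h')).symm s _

theorem pushMap_naturality {i j : J} (h : i ≤ j) {s t : U.obj (F.obj i).base} (e : s ≤ t) :
    atLE (F.obj i).fib e ≫ pushMap F h t =
      pushMap F h s ≫ atLE (F.obj j).fib (show push F h s ≤ push F h t from app_mono U _ e) :=
  (F.map (homOfLE h)).naturality e

/-- For `s ∈ S_i`, the inductive system of the groups `G_j (α_ij (s))`, indexed by all `j ≥ i`, with
the connecting maps `(η_jk)_{α_ij (s)} : G_j (α_ij (s)) ⟶ G_k (α_jk (α_ij (s))) = G_k (α_ik (s))`. -/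
def fibSystem (i : J) (s : U.obj (F.obj i).base) :
    {j : J // i ≤ j} ⥤ AddCommGrpCat.{u} where
  obj j := (F.obj j.1).fib.obj (push F j.2 s)
  map {j k} f := pushMap F f.le (push F j.2 s) ≫
    atLE (F.obj k.1).fib (push_push F j.2 f.le s).le
  map_id j := pushMap_refl F _ _
  map_comp {j k l} f g := by
    have h1 := pushMap_naturality F g.le (push_push F j.2 f.le s).le
    have h2 := pushMap_pushMap F f.le g.le (push F j.2 s)
    simp only [Category.assoc]
    rw [reassoc_of% h1, ← h2]
    simp only [Category.assoc, atLE_trans]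

variable {F}

theorem app_push (d : Cocone (F ⋙ toBase U P)) {i j : J} (h : i ≤ j) (s : U.obj (F.obj i).base) :
    app U (d.ι.app j) (push F h s) = app U (d.ι.app i) s :=
  (app_comp U _ _ s).symm.trans (congrArg (fun α => app U α s) (d.w (homOfLE h)))

/-- A functor `G` from the poset `S_∞` to abelian groups together with natural transformations
`η_i : G_i ⟶ G ∘ α_i∞` that are compatible with the `η_ij`: for `i ≤ j` and `s ∈ S_i`,
`(η_j)_{α_ij (s)} ∘ (η_ij)_s = (η_i)_s`. -/
structure FibCocone (d : Cocone (F ⋙ toBase U P)) where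
  fib : U.obj d.pt ⥤ AddCommGrpCat.{u}
  trans (i : J) (s : U.obj (F.obj i).base) :
    (F.obj i).fib.obj s ⟶ fib.obj (app U (d.ι.app i) s)
  naturality (i : J) {s t : U.obj (F.obj i).base} (h : s ≤ t) :
    atLE (F.obj i).fib h ≫ trans i t = trans i s ≫ atLE fib (app_mono U (d.ι.app i) h)
  comm {i j : J} (h : i ≤ j) (s : U.obj (F.obj i).base) :
    pushMap F h s ≫ trans j (push F h s) ≫ atLE fib (app_push d h s).le = trans i s

namespace FibCocone

variable {d : Cocone (F ⋙ toBase U P)} (L : FibCocone d)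

/-- For `s ∈ S_i`, the group `G (α_i∞ (s))` with the maps
`(η_j)_{α_ij (s)} : G_j (α_ij (s)) ⟶ G (α_j∞ (α_ij (s))) = G (α_i∞ (s))`, `j ≥ i`, as a cocone on the
inductive system of the groups `G_j (α_ij (s))`. -/
def fibCocone (i : J) (s : U.obj (F.obj i).base) : Cocone (fibSystem F i s) where
  pt := L.fib.obj (app U (d.ι.app i) s)
  ι :=
    { app := fun j => L.trans j.1 (push F j.2 s) ≫ atLE L.fib (app_push d j.2 s).le
      naturality := fun j k f => by
        have h1 := L.naturality k.1 (push_push F j.2 f.le s).le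
        have h2 := L.comm f.le (push F j.2 s)
        change (pushMap F f.le (push F j.2 s) ≫ atLE (F.obj k.1).fib _) ≫
          L.trans k.1 _ ≫ atLE L.fib _ = (L.trans j.1 _ ≫ atLE L.fib _) ≫ 𝟙 _
        rw [Category.comp_id, Category.assoc, reassoc_of% h1, ← h2]
        simp only [Category.assoc, atLE_trans] }

/-- The group `G (α_i∞ (s))`, with the maps `(η_j)_{α_ij (s)}`, is the inductive limit of the groups
`G_j (α_ij (s))`, for every `i` and every `s ∈ S_i`. As `G` is a functor and the `η_i` are natural, the
map `G (α_i∞ (s) ≤ α_j∞ (t))` is the one that the maps `G_k (α_ik (s) ≤ α_jk (t))` induce. -/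
def IsAlgebraicLimit : Prop :=
  ∀ (i : J) (s : U.obj (F.obj i).base), Nonempty (IsColimit (L.fibCocone i s))

/-- `G` is an algebraic limit, and it is completed: if an element `s` of `S_∞` is the supremum of a
`≪`-increasing sequence `(x_n)` of elements of the union of the `α_i∞ (S_i)`, then `G (s)` is the
inductive limit of the groups `G (x_n)`. -/
def IsCompletedLimit : Prop :=
  L.IsAlgebraicLimit ∧
    ∀ (X : ℕ ⥤ U.obj d.pt) (c : Cocone X),
      (∀ n, ∃ (i : J) (s : U.obj (F.obj i).base), X.obj n = app U (d.ι.app i) s) →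
      (∀ n, WayBelow (X.obj n) (X.obj (n + 1))) →
      IsLUB (Set.range X.obj) c.pt →
        Nonempty (IsColimit (L.fib.mapCocone c))

/-- The cocone `((S_∞, G), (α_i∞, η_i))` on `F`, if `(S_∞, G)` is a group system. -/
def toCocone (h : P d.pt L.fib) : Cocone F where
  pt := { base := d.pt, fib := L.fib, property := h }
  ι :=
    { app := fun i =>
        { base := d.ι.app i
          trans := L.trans i
          naturality := L.naturality i }
      naturality := fun _ _ f =>
        (comp_eq_of (d.w f) fun s _ => L.comm f.le s).trans (Category.comp_id _).symm }

end FibCocone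

end GroupSystem

end GroupSystems

/-! ### The three categories of group systems -/

/-- `PoS_*Gp`: the base category is the category of partially ordered sets. -/
abbrev PoSGp : Type (u + 1) :=
  GroupSystem (𝟭 PartOrd.{u}) fun _ _ => True

/-- The condition on the functor `G` of a pomonoid group system: the group `G (0)` is trivial. -/
def PoM.Admissible (S : PoM.{u}) (G : PoM.toPartOrd.obj S ⥤ AddCommGrpCat.{u}) : Prop :=
  Subsingleton (G.obj (0 : S))

/-- `PoM_*Gp`: the category of pomonoid group systems. -/
abbrev PoMGp : Type (u + 1) :=
  GroupSystem PoM.toPartOrd.{u} PoM.Admissible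

/-- The condition on the functor `G` of a Cuntz group system: the group `G (0)` is trivial, and `G`
preserves inductive limits of increasing sequences, that is, `G (sup x_n)` is the inductive limit of
the groups `G (x_n)`. -/
def CuSemigroup.Admissible (S : CuSemigroup.{u})
    (G : CuSemigroup.toPartOrd.obj S ⥤ AddCommGrpCat.{u}) : Prop :=
  Subsingleton (G.obj (0 : S)) ∧ PreservesColimitsOfShape ℕ G

/-- `Cu_*Gp`: the category of Cuntz group systems. -/
abbrev CuGp : Type (u + 1) :=
  GroupSystem CuSemigroup.toPartOrd.{u} CuSemigroup.Admissible

/-!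
The theorem rests on one observation: in all three cases the limit functors are the left Kan
extensions. Let an inductive system of group systems `(S_i, G_i)` and a cocone `(S_∞, α_i∞)` on the
underlying system be given. The pairs `(i, t)` with `t ∈ S_i` form a preorder (`Elements`), on which
`(i, t) ↦ G_i (t)` is a functor, and `(i, t) ↦ α_i∞ (t)` is a monotone map to `S_∞`. A functor `G` on
`S_∞` with transformations `G_i ⟶ G ∘ α_i∞` is a left Kan extension along this map
(`FibCocone.IsKanExtension`) if every `G (s)` is the inductive limit of the `G_i (t)` with
`α_i∞ (t) ≤ s`. Such a `G` always exists (`FibCocone.exists_isKanExtension`), and if `S_∞` is an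
inductive limit, then the universal property of the groups `G (s)` yields that of `(S_∞, G)` in the
category of group systems (`FibCocone.IsKanExtension.isColimit_toCocone`).

It remains to compare Kan extensions with algebraic and completed limits. This means to compare
inductive limits over different sets of elements. The tool is an approximation relation `t' ◁ t` on
the `S_i` such that `G_i (t)` is the inductive limit of the `G_i (t')` with `t' ◁ t`: for posets and
pomonoids the order, for Cuntz semigroups the way-below relation, where the property is the
continuity of `G_i`. If a set of elements contains all approximants of the members of a larger one,
then compatible families of homomorphisms extend uniquely from the smaller set to the larger one
(`Approximation.Dense.hom_ext`, `Approximation.Dense.exists_extension`), so that the inductive limits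
agree. Applied to the elements that are eventually below a given `s ∈ S_i`, this identifies the group
of the Kan extension at `α_i∞ (s)` with that of an algebraic limit. Applied to the elements whose
images are below some term of a sequence, it shows that for Cuntz semigroups a Kan extension
preserves suprema of increasing sequences, and that it is determined by the groups at the union of
the images of the `S_i`.

The density statements need some knowledge of the inductive limits in the base categories. Those of
posets and pomonoids are the set-theoretic ones (`OrderDirectLimit`). For Cuntz semigroups, the limit
of pomonoids carries an auxiliary relation `≺` induced by the way-below relations of the `S_i`, and
the inductive limit is the completion by countably generated round ideals
(`AuxiliaryRelation.completion`). There, suprema of increasing sequences are unions, `I ≪ J` means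
that some element of `J` dominates `I`, and the union of the images of the `S_i` is dense.
-/

namespace GroupSystem

variable {C : Type v} [Category.{u} C] {U : C ⥤ PartOrd.{u}}
  {P : ∀ S : C, (U.obj S ⥤ AddCommGrpCat.{u}) → Prop} {J : Type u} [Preorder J]

/-- The inclusion of a subset of a preorder, as a functor. -/
def valFunctor {S : Type u} [Preorder S] (D : Set S) : D ⥤ S :=
  Monotone.functor (f := fun x : D => x.1) fun _ _ h => h

/-- A naturality square, composed with `p` and with homomorphisms between the values of `G`. -/
theorem comp_atLE_of_square {S : Type u} [Preorder S] {G : S ⥤ AddCommGrpCat.{u}}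
    {X A B : AddCommGrpCat.{u}} {x y z w : S} (p : X ⟶ A) {a : A ⟶ B} {g : B ⟶ G.obj x}
    {g' : A ⟶ G.obj y} {hyx : y ≤ x} (nat : a ≫ g = g' ≫ atLE G hyx) (hyw : y ≤ w) (hxz : x ≤ z)
    (hwz : w ≤ z) :
    (p ≫ a) ≫ g ≫ atLE G hxz = (p ≫ g' ≫ atLE G hyw) ≫ atLE G hwz := by
  simp only [Category.assoc, atLE_trans]
  rw [reassoc_of% nat, atLE_trans]

/-! ### The category of elements of an inductive system -/

section Elements

variable (F : J ⥤ GroupSystem U P)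

/-- The elements of an inductive system of group systems: the pairs `(i, s)` with `s ∈ S_i`. They are
preordered by `(i, s) ≤ (j, t)` if `i ≤ j` and `α_ij (s) ≤ t`. -/
structure Elements : Type u where
  idx : J
  val : U.obj (F.obj idx).base

instance : Preorder (Elements F) where
  le x y := ∃ h : x.idx ≤ y.idx, push F h x.val ≤ y.val
  le_refl x := ⟨le_rfl, (push_refl F _ _).le⟩
  le_trans x y z := fun ⟨h, e⟩ ⟨h', e'⟩ =>
    ⟨h.trans h', (push_push F h h' x.val).ge.trans ((app_mono U _ e).trans e')⟩

/-- The homomorphism `G_i (s) ⟶ G_j (α_ij (s)) ⟶ G_j (t)`, where `i ≤ j` and `α_ij (s) ≤ t`. -/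
def transport {i j : J} (h : i ≤ j) {s : U.obj (F.obj i).base} {t : U.obj (F.obj j).base}
    (e : push F h s ≤ t) : (F.obj i).fib.obj s ⟶ (F.obj j).fib.obj t :=
  pushMap F h s ≫ atLE (F.obj j).fib e

theorem transport_refl {i : J} (h : i ≤ i) {s : U.obj (F.obj i).base} (e : push F h s ≤ s) :
    transport F h e = 𝟙 _ :=
  pushMap_refl F h s

theorem transport_of_le {i : J} (h : i ≤ i) {s t : U.obj (F.obj i).base} (e : push F h s ≤ t)
    (e' : s ≤ t) : transport F h e = atLE (F.obj i).fib e' := by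
  have h1 := pushMap_refl F h s
  rw [transport, ← Category.id_comp (atLE _ e'), ← h1, Category.assoc, atLE_trans]

theorem transport_transport {i j k : J} (h : i ≤ j) (h' : j ≤ k) {r : U.obj (F.obj i).base}
    {s : U.obj (F.obj j).base} {t : U.obj (F.obj k).base} (e : push F h r ≤ s)
    (e' : push F h' s ≤ t) (e'' : push F (h.trans h') r ≤ t) :
    transport F h e ≫ transport F h' e' = transport F (h.trans h') e'' := by
  have h1 := pushMap_naturality F h' e
  have h2 := pushMap_pushMap F h h' r
  simp only [transport, Category.assoc]
  rw [reassoc_of% h1, ← h2]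
  simp only [Category.assoc, atLE_trans]

variable {F} in
/-- Homomorphisms out of the groups `G_i (s)` that are natural and compatible with the connecting
maps are compatible with the maps `transport`. -/
theorem transport_comp {S : Type u} [Preorder S] {G : S ⥤ AddCommGrpCat.{u}} {i j : J} (h : i ≤ j)
    {r : U.obj (F.obj i).base} {t : U.obj (F.obj j).base} (e : push F h r ≤ t) {a b c s : S}
    {f : (F.obj i).fib.obj r ⟶ G.obj a} {g : (F.obj j).fib.obj (push F h r) ⟶ G.obj b}
    {k : (F.obj j).fib.obj t ⟶ G.obj c} {hbc : b ≤ c} {hba : b ≤ a}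
    (nat : atLE (F.obj j).fib e ≫ k = g ≫ atLE G hbc)
    (comm : pushMap F h r ≫ g ≫ atLE G hba = f) (hcs : c ≤ s) (has : a ≤ s) :
    transport F h e ≫ k ≫ atLE G hcs = f ≫ atLE G has := by
  rw [← comm]
  simp only [transport, Category.assoc]
  rw [reassoc_of% nat]
  simp only [atLE_trans]

/-- The functor `(i, s) ↦ G_i (s)` on the elements of an inductive system. -/
def elementsFib : Elements F ⥤ AddCommGrpCat.{u} where
  obj x := (F.obj x.idx).fib.obj x.val
  map f := transport F (leOfHom f).fst (leOfHom f).snd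
  map_id _ := transport_refl F _ _
  map_comp _ _ := (transport_transport F _ _ _ _ _).symm

/-- The restriction of the functor `(i, s) ↦ G_i (s)` to a set of elements. -/
def diagram (E : Set (Elements F)) : E ⥤ AddCommGrpCat.{u} :=
  valFunctor E ⋙ elementsFib F

variable {F}

theorem diagram_naturality {E : Set (Elements F)} {A : AddCommGrpCat.{u}}
    (σ : diagram F E ⟶ (Functor.const E).obj A) {x y : Elements F} (hx : x ∈ E) (hy : y ∈ E)
    (h : x.idx ≤ y.idx) (e : push F h x.val ≤ y.val) :
    transport F h e ≫ σ.app ⟨y, hy⟩ = σ.app ⟨x, hx⟩ := by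
  have := σ.naturality (X := ⟨x, hx⟩) (Y := ⟨y, hy⟩) (homOfLE ⟨h, e⟩)
  exact this.trans (Category.comp_id _)

/-- A compatible family of homomorphisms `G_i (s) ⟶ A`, for the elements `(i, s)` of a set. -/
def diagramHom {E : Set (Elements F)} {A : AddCommGrpCat.{u}}
    (σ : ∀ x ∈ E, (F.obj x.idx).fib.obj x.val ⟶ A)
    (hσ : ∀ x y (hx : x ∈ E) (hy : y ∈ E) (h : x.idx ≤ y.idx) (e : push F h x.val ≤ y.val),
      transport F h e ≫ σ y hy = σ x hx) : diagram F E ⟶ (Functor.const E).obj A where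
  app x := σ x.1 x.2
  naturality x y f :=
    (hσ x.1 y.1 x.2 y.2 (leOfHom f).fst (leOfHom f).snd).trans (Category.comp_id _).symm

/-- The inclusion of a set of elements into a larger set. -/
def inclusion {E E' : Set (Elements F)} (h : E ⊆ E') : E ⥤ E' :=
  Monotone.functor (f := Set.inclusion h) fun _ _ hab => hab

end Elements

/-! ### Approximation relations -/

section Approximation

variable (F : J ⥤ GroupSystem U P)

/-- The cocone on the groups `G_i (t')` for `t' ∈ D`, `D` a set of lower bounds of `t`, with
vertex `G_i (t)`. -/
def lowerCocone {S : Type u} [Preorder S] (G : S ⥤ AddCommGrpCat.{u}) (t : S) (D : Set S)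
    (hD : ∀ x ∈ D, x ≤ t) : Cocone (valFunctor D ⋙ G) where
  pt := G.obj t
  ι :=
    { app := fun x => atLE G (hD x.1 x.2)
      naturality := fun _ _ _ => (atLE_trans G _ _).trans (Category.comp_id _).symm }

/-- An approximation relation `t' ◁ t` on the members of an inductive system: it refines the order,
it is preserved by the connecting maps, and every group `G_i (t)` is the inductive limit of the
groups `G_i (t')` with `t' ◁ t`. For posets and pomonoids this is the order itself, and for Cuntz
semigroups it is the way-below relation. -/
structure Approximation where
  rel (i : J) : U.obj (F.obj i).base → U.obj (F.obj i).base → Prop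
  le {i : J} {s t : U.obj (F.obj i).base} : rel i s t → s ≤ t
  trans_le {i : J} {r s t : U.obj (F.obj i).base} : rel i r s → s ≤ t → rel i r t
  rel_push {i j : J} (h : i ≤ j) {s t : U.obj (F.obj i).base} :
    rel i s t → rel j (push F h s) (push F h t)
  isColimit (i : J) (t : U.obj (F.obj i).base) :
    Nonempty (IsColimit (lowerCocone (F.obj i).fib t {s | rel i s t} fun _ => le))

variable {F} (R : Approximation F) {E E' : Set (Elements F)}

/-- A set `E` of elements is dense in `E'` if it contains all approximants of the members of `E'`. -/
def Approximation.Dense (E E' : Set (Elements F)) : Prop :=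
  ∀ x ∈ E', ∀ t, R.rel x.idx t x.val → (⟨x.idx, t⟩ : Elements F) ∈ E

variable {R}

/-- Compatible families are determined by their restrictions to dense subsets. -/
theorem Approximation.Dense.hom_ext (hd : R.Dense E E') (hE : E ⊆ E') {A : AddCommGrpCat.{u}}
    {σ τ : diagram F E' ⟶ (Functor.const E').obj A}
    (h : ∀ x (hx : x ∈ E), σ.app ⟨x, hE hx⟩ = τ.app ⟨x, hE hx⟩) : σ = τ := by
  ext1
  funext ⟨x, hx⟩
  obtain ⟨hc⟩ := R.isColimit x.idx x.val
  refine hc.hom_ext fun ⟨t, ht⟩ => ?_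
  have hmem : (⟨x.idx, t⟩ : Elements F) ∈ E := hd x hx t ht
  have e : push F le_rfl t ≤ x.val := (push_refl F _ t).le.trans (R.le ht)
  have h1 := diagram_naturality σ (hE hmem) hx le_rfl e
  have h2 := diagram_naturality τ (hE hmem) hx le_rfl e
  rw [transport_of_le F le_rfl e (R.le ht)] at h1 h2
  exact h1.trans ((h _ hmem).trans h2.symm)

/-- Compatible families extend from dense subsets. -/
theorem Approximation.Dense.exists_extension (hd : R.Dense E E') (hE : E ⊆ E')
    {A : AddCommGrpCat.{u}} (σ : diagram F E ⟶ (Functor.const E).obj A) :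
    ∃ τ : diagram F E' ⟶ (Functor.const E').obj A,
      ∀ x (hx : x ∈ E), τ.app ⟨x, hE hx⟩ = σ.app ⟨x, hx⟩ := by
  -- At `(i, t)`, the extension is induced by the maps at the approximants of `t`.
  have key : ∀ x (_ : x ∈ E'), ∃ f : (F.obj x.idx).fib.obj x.val ⟶ A,
      ∀ t (ht : R.rel x.idx t x.val) (hm : (⟨x.idx, t⟩ : Elements F) ∈ E),
        atLE (F.obj x.idx).fib (R.le ht) ≫ f = σ.app ⟨⟨x.idx, t⟩, hm⟩ := by
    intro x hx
    obtain ⟨hc⟩ := R.isColimit x.idx x.val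
    let c : Cocone (valFunctor {t | R.rel x.idx t x.val} ⋙ (F.obj x.idx).fib) :=
      { pt := A
        ι :=
          { app := fun t => σ.app ⟨⟨x.idx, t.1⟩, hd x hx t.1 t.2⟩
            naturality := fun s t f => by
              have e : push F le_rfl s.1 ≤ t.1 := (push_refl F _ s.1).le.trans (leOfHom f)
              have h1 := diagram_naturality σ (hd x hx s.1 s.2) (hd x hx t.1 t.2) le_rfl e
              rw [transport_of_le F le_rfl e (leOfHom f)] at h1
              exact h1.trans (Category.comp_id _).symm } }
    exact ⟨hc.desc c, fun t ht _ => hc.fac c ⟨t, ht⟩⟩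
  choose f hf using key
  refine ⟨diagramHom f fun x y hx hy h e => ?_, fun x hx => ?_⟩
  · obtain ⟨hc⟩ := R.isColimit x.idx x.val
    refine hc.hom_ext fun ⟨t, ht⟩ => ?_
    -- Both composites are the map at `(i, t)`, one of them through the approximant `α_ij (t)`.
    have ht' : R.rel y.idx (push F h t) y.val := R.trans_le (R.rel_push h ht) e
    have h1 := hf x hx t ht (hd x hx t ht)
    have h2 := hf y hy _ ht' (hd y hy _ ht')
    have h3 := diagram_naturality σ (hd x hx t ht) (hd y hy _ ht') h le_rfl
    refine Eq.trans ?_ h1.symm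
    rw [← h3, ← h2]
    change atLE (F.obj x.idx).fib (R.le ht) ≫ transport F h e ≫ f y hy = _
    have h4 := pushMap_naturality F h (R.le ht)
    simp only [transport, Category.assoc]
    rw [reassoc_of% h4, atLE_trans_assoc, atLE_trans_assoc]
  · obtain ⟨hc⟩ := R.isColimit x.idx x.val
    refine hc.hom_ext fun ⟨t, ht⟩ => ?_
    have hm := hd x (hE hx) t ht
    have e : push F le_rfl t ≤ x.val := (push_refl F _ t).le.trans (R.le ht)
    have h1 := diagram_naturality σ hm hx le_rfl e
    rw [transport_of_le F le_rfl e (R.le ht)] at h1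
    exact (hf x (hE hx) t ht hm).trans h1.symm

/-- Colimits may be computed on dense subsets. -/
theorem Approximation.Dense.isColimit_whisker_iff (hd : R.Dense E E') (hE : E ⊆ E')
    (c : Cocone (diagram F E')) :
    Nonempty (IsColimit (c.whisker (inclusion hE))) ↔ Nonempty (IsColimit c) := by
  constructor
  · rintro ⟨hc⟩
    refine ⟨IsColimit.ofExistsUnique fun s => ?_⟩
    refine ⟨hc.desc (s.whisker (inclusion hE)), ?_, fun g hg => hc.hom_ext fun x => ?_⟩
    · have : c.ι ≫ (Functor.const E').map (hc.desc (s.whisker (inclusion hE))) = s.ι :=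
        hd.hom_ext hE fun x hx => hc.fac (s.whisker (inclusion hE)) ⟨x, hx⟩
      exact fun x => NatTrans.congr_app this x
    · rw [hc.fac]
      exact hg ((inclusion hE).obj x)
  · rintro ⟨hc⟩
    refine ⟨IsColimit.ofExistsUnique fun s => ?_⟩
    obtain ⟨τ, hτ⟩ := hd.exists_extension hE s.ι
    refine ⟨hc.desc ⟨s.pt, τ⟩, fun x => ?_, fun g hg => hc.hom_ext fun x => ?_⟩
    · exact (hc.fac ⟨s.pt, τ⟩ ((inclusion hE).obj x)).trans (hτ x.1 x.2)
    · rw [hc.fac]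
      have : c.ι ≫ (Functor.const E').map g = τ :=
        hd.hom_ext hE fun x hx => (hg ⟨x, hx⟩).trans (hτ x hx).symm
      exact NatTrans.congr_app this x

end Approximation

/-! ### Limit functors as left Kan extensions -/

variable {F : J ⥤ GroupSystem U P}

/-- The elements `(i, t)` with `α_i∞ (t) ≤ s`. -/
def below (d : Cocone (F ⋙ toBase U P)) (s : U.obj d.pt) : Set (Elements F) :=
  {x | app U (d.ι.app x.idx) x.val ≤ s}

theorem below_mono (d : Cocone (F ⋙ toBase U P)) {s t : U.obj d.pt} (h : s ≤ t) :
    below d s ⊆ below d t :=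
  fun _ hx => le_trans hx h

/-- The elements `(j, t)` whose image in some `S_k` is below the image of `s ∈ S_i`. -/
def eventuallyBelow (i : J) (s : U.obj (F.obj i).base) : Set (Elements F) :=
  {x | ∃ (k : J) (h : i ≤ k), x ≤ ⟨k, push F h s⟩}

theorem eventuallyBelow_subset (d : Cocone (F ⋙ toBase U P)) (i : J)
    (s : U.obj (F.obj i).base) : eventuallyBelow i s ⊆ below d (app U (d.ι.app i) s) := by
  rintro x ⟨k, h, hx, e⟩
  change app U (d.ι.app x.idx) x.val ≤ _
  rw [← app_push d hx, ← app_push d h]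
  exact app_mono U _ e

/-- The map `j ↦ (j, α_ij (s))` from the indices `j ≥ i`. -/
def orbit (i : J) (s : U.obj (F.obj i).base) :
    {j : J // i ≤ j} ⥤ (eventuallyBelow i s : Set (Elements F)) :=
  Monotone.functor (f := fun j => ⟨⟨j.1, push F j.2 s⟩, j.1, j.2, le_rfl⟩)
    fun _ _ h => ⟨h, (push_push F _ _ s).le⟩

/-- The elements `(j, α_ij (s))` are cofinal among those that are eventually below `s`, so that the
inductive limit of the groups `G_j (α_ij (s))` is that of all groups of elements eventually below
`s`. -/
instance orbit_final [IsDirectedOrder J] (i : J) (s : U.obj (F.obj i).base) :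
    (orbit i s).Final := by
  have : IsDirectedOrder {j : J // i ≤ j} := ⟨fun a b => by
    obtain ⟨k, ha, hb⟩ := exists_ge_ge a.1 b.1
    exact ⟨⟨k, a.2.trans ha⟩, ha, hb⟩⟩
  refine Functor.final_of_exists_of_isFiltered _ ?_ fun {_ c} _ _ => ⟨c, 𝟙 c, rfl⟩
  rintro ⟨x, k, h, hx⟩
  exact ⟨⟨k, h⟩, ⟨homOfLE hx⟩⟩

namespace FibCocone

variable {d : Cocone (F ⋙ toBase U P)} (L : FibCocone d)

/-- The homomorphism `G_i (t) ⟶ G (α_i∞ (t)) ⟶ G (s)`, where `α_i∞ (t) ≤ s`. -/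
def transTo {s : U.obj d.pt} (x : Elements F) (hx : x ∈ below d s) :
    (F.obj x.idx).fib.obj x.val ⟶ L.fib.obj s :=
  L.trans x.idx x.val ≫ atLE L.fib hx

theorem transTo_self (i : J) (t : U.obj (F.obj i).base) :
    L.transTo ⟨i, t⟩ (le_refl (app U (d.ι.app i) t)) = L.trans i t :=
  (congrArg (L.trans i t ≫ ·) (atLE_refl L.fib _)).trans (Category.comp_id _)

theorem transTo_atLE {s s' : U.obj d.pt} (x : Elements F) (hx : x ∈ below d s) (e : s ≤ s') :
    L.transTo x hx ≫ atLE L.fib e = L.transTo x (below_mono d e hx) :=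
  (Category.assoc _ _ _).trans (congrArg (L.trans x.idx x.val ≫ ·) (atLE_trans L.fib _ _))

theorem transport_transTo {s : U.obj d.pt} (x y : Elements F) (hx : x ∈ below d s)
    (hy : y ∈ below d s) (h : x.idx ≤ y.idx) (e : push F h x.val ≤ y.val) :
    transport F h e ≫ L.transTo y hy = L.transTo x hx :=
  transport_comp h e (L.naturality y.idx e) (L.comm h x.val) hy hx

/-- The group `G (s)`, with the homomorphisms `G_i (t) ⟶ G (s)` for `α_i∞ (t) ≤ s`. -/
def belowCocone (s : U.obj d.pt) : Cocone (diagram F (below d s)) where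
  pt := L.fib.obj s
  ι := diagramHom L.transTo L.transport_transTo

/-- `G` is the (pointwise) left Kan extension of `(i, t) ↦ G_i (t)` along `(i, t) ↦ α_i∞ (t)`:
every group `G (s)` is the inductive limit of the groups `G_i (t)` with `α_i∞ (t) ≤ s`. -/
def IsKanExtension : Prop :=
  ∀ s : U.obj d.pt, Nonempty (IsColimit (L.belowCocone s))

variable {L}

/-- The universal property of a left Kan extension, in the category of group systems. -/
theorem IsKanExtension.isColimit_toCocone (hL : L.IsKanExtension) (hd : IsColimit d)
    (h : P d.pt L.fib) : Nonempty (IsColimit (L.toCocone h)) := by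
  refine ⟨IsColimit.ofExistsUnique fun e => ?_⟩
  let b : d.pt ⟶ e.pt.base := hd.desc ((toBase U P).mapCocone e)
  have hb : ∀ i, d.ι.app i ≫ b = (e.ι.app i).base := hd.fac ((toBase U P).mapCocone e)
  have hbs : ∀ (i : J) (t : U.obj (F.obj i).base),
      app U b (app U (d.ι.app i) t) = app U (e.ι.app i).base t := fun i t =>
    (app_comp U _ _ t).symm.trans (congrArg (fun α => app U α t) (hb i))
  have hle : ∀ {s : U.obj d.pt} (x : Elements F), x ∈ below d s →
      app U (e.ι.app x.idx).base x.val ≤ app U b s := fun x hx =>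
    (hbs _ _).ge.trans (app_mono U b hx)
  have key : ∀ s : U.obj d.pt, ∃ f : L.fib.obj s ⟶ e.pt.fib.obj (app U b s),
      ∀ (x : Elements F) (hx : x ∈ below d s),
        L.transTo x hx ≫ f = (e.ι.app x.idx).trans x.val ≫ atLE e.pt.fib (hle x hx) := by
    intro s
    obtain ⟨hc⟩ := hL s
    let c : Cocone (diagram F (below d s)) :=
      { pt := e.pt.fib.obj (app U b s)
        ι := diagramHom
          (fun x hx => (e.ι.app x.idx).trans x.val ≫ atLE e.pt.fib (hle x hx))
          fun x y hx hy h l => by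
            have hw : F.map (homOfLE h) ≫ e.ι.app y.idx = e.ι.app x.idx :=
              (e.ι.naturality (homOfLE h)).trans (Category.comp_id _)
            have hpush : app U (e.ι.app y.idx).base (push F h x.val) =
                app U (e.ι.app x.idx).base x.val :=
              ((hbs _ _).symm.trans (congrArg (app U b) (app_push d h x.val))).trans (hbs _ _)
            exact transport_comp h l ((e.ι.app y.idx).naturality l)
              (trans_of_comp_eq hw x.val hpush.le) (hle y hy) (hle x hx) }
    exact ⟨hc.desc c, fun x hx => hc.fac c ⟨x, hx⟩⟩
  choose f hf using key
  have hnat : ∀ {s t : U.obj d.pt} (l : s ≤ t),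
      atLE L.fib l ≫ f t = f s ≫ atLE e.pt.fib (app_mono U b l) := by
    intro s t l
    obtain ⟨hc⟩ := hL s
    refine hc.hom_ext fun ⟨x, hx⟩ => ?_
    change L.transTo x hx ≫ _ ≫ _ = L.transTo x hx ≫ _ ≫ _
    rw [reassoc_of% (hf s x hx), atLE_trans, ← Category.assoc, transTo_atLE, hf]
  let m : (L.toCocone h).pt ⟶ e.pt := { base := b, trans := f, naturality := hnat }
  refine ⟨m, fun i => comp_eq_of (hb i) fun t l => ?_, fun g hg => ?_⟩
  · have h1 := hf _ ⟨i, t⟩ (le_refl (app U (d.ι.app i) t))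
    rw [transTo_self] at h1
    refine (Category.assoc _ _ _).symm.trans ((congrArg (· ≫ atLE e.pt.fib l) h1).trans ?_)
    refine (Category.assoc _ _ _).trans (Eq.trans (congrArg ((e.ι.app i).trans t ≫ ·) ?_)
      (Category.comp_id _))
    exact (atLE_trans _ _ _).trans (atLE_refl _ _)
  · have hgb : g.base = b := hd.hom_ext fun i =>
      (congrArg (fun k : F.obj i ⟶ e.pt => k.base) (hg i)).trans (hb i).symm
    refine Hom.ext' hgb fun (s : U.obj d.pt) l => ?_
    obtain ⟨hc⟩ := hL s
    refine hc.hom_ext fun ⟨x, hx⟩ => ?_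
    have hgs : app U g.base (app U (d.ι.app x.idx) x.val) ≤ app U (e.ι.app x.idx).base x.val :=
      ((congrArg (fun α => app U α _) hgb).trans (hbs x.idx x.val)).le
    have h1 := trans_of_comp_eq (hg x.idx) x.val hgs
    have h2 := g.naturality (s := app U (d.ι.app x.idx) x.val) (t := s) hx
    refine Eq.trans ?_ (hf s x hx).symm
    rw [← h1]
    exact comp_atLE_of_square (L.trans x.idx x.val) h2 hgs _ _

/-- The left Kan extension exists. -/
theorem exists_isKanExtension (d : Cocone (F ⋙ toBase U P)) :
    ∃ L : FibCocone d, L.IsKanExtension := by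
  let G : U.obj d.pt → AddCommGrpCat.{u} := fun s => colimit (diagram F (below d s))
  let ι : ∀ {s : U.obj d.pt} (x : Elements F), x ∈ below d s →
      ((F.obj x.idx).fib.obj x.val ⟶ G s) := fun {s} x hx =>
    colimit.ι (diagram F (below d s)) ⟨x, hx⟩
  have hι : ∀ {s : U.obj d.pt} (x y : Elements F) (hx : x ∈ below d s) (hy : y ∈ below d s)
      (h : x.idx ≤ y.idx) (e : push F h x.val ≤ y.val),
      transport F h e ≫ ι y hy = ι x hx := fun x y hx hy h e =>
    colimit.w (diagram F (below d _))
      (homOfLE (show (⟨x, hx⟩ : below d _) ≤ ⟨y, hy⟩ from ⟨h, e⟩))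
  let m : ∀ {s t : U.obj d.pt}, s ≤ t → (G s ⟶ G t) := fun {s t} h =>
    colimit.desc (diagram F (below d s)) ⟨G t,
      diagramHom (fun x hx => ι x (below_mono d h hx)) fun x y hx hy => hι x y _ _⟩
  have hm : ∀ {s t : U.obj d.pt} (h : s ≤ t) (x : Elements F) (hx : x ∈ below d s),
      ι x hx ≫ m h = ι x (below_mono d h hx) := fun h x hx => colimit.ι_desc _ _
  have hext : ∀ {s : U.obj d.pt} {A : AddCommGrpCat.{u}} {f g : G s ⟶ A},
      (∀ x (hx : x ∈ below d s), ι x hx ≫ f = ι x hx ≫ g) → f = g := fun h =>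
    colimit.hom_ext fun x => h x.1 x.2
  let fib : U.obj d.pt ⥤ AddCommGrpCat.{u} :=
    { obj := G
      map := fun f => m (leOfHom f)
      map_id := fun s => hext fun x hx => (hm (le_refl s) x hx).trans (Category.comp_id _).symm
      map_comp := fun f g => hext fun x hx => by
        have h1 := hm (leOfHom f) x hx
        have h2 := hm (leOfHom g) x (below_mono d (leOfHom f) hx)
        exact (hm (leOfHom (f ≫ g)) x hx).trans (by rw [← h2, ← h1, Category.assoc]) }
  let L : FibCocone d :=
    { fib := fib
      trans := fun i s => ι ⟨i, s⟩ le_rfl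
      naturality := fun i s t h => by
        have e : push F le_rfl s ≤ t := (push_refl F _ s).le.trans h
        refine Eq.trans ?_ (hm (app_mono U (d.ι.app i) h) ⟨i, s⟩ le_rfl).symm
        rw [← transport_of_le F le_rfl e h]
        exact hι ⟨i, s⟩ ⟨i, t⟩ (app_mono U _ h) le_rfl le_rfl e
      comm := fun {i j} h s => by
        refine Eq.trans (congrArg (pushMap F h s ≫ ·)
          (hm (app_push d h s).le ⟨j, push F h s⟩ le_rfl)) ?_
        refine Eq.trans ?_ (hι ⟨i, s⟩ ⟨j, push F h s⟩ le_rfl (app_push d h s).le h le_rfl)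
        rw [transport, atLE_refl, Category.comp_id] }
  refine ⟨L, fun s => ⟨IsColimit.ofIsoColimit (colimit.isColimit (diagram F (below d s)))
    (Cocone.ext (Iso.refl _) fun x => ?_)⟩⟩
  exact (Category.comp_id _).trans (hm x.2 x.1 le_rfl).symm

variable (L)

/-- If every approximant of an element of `S_j` whose image in `S_∞` is below that of `s ∈ S_i` is
below `s` at some stage, then the group at `α_i∞ (s)` of an algebraic limit is that of a left Kan
extension. -/
theorem isColimit_fibCocone_iff [IsDirectedOrder J] (R : Approximation F) (i : J)
    (s : U.obj (F.obj i).base)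
    (hR : R.Dense (eventuallyBelow i s) (below d (app U (d.ι.app i) s))) :
    Nonempty (IsColimit (L.fibCocone i s)) ↔
      Nonempty (IsColimit (L.belowCocone (app U (d.ι.app i) s))) := by
  rw [← hR.isColimit_whisker_iff (eventuallyBelow_subset d i s)]
  exact (Functor.Final.isColimitWhiskerEquiv (orbit i s)
    ((L.belowCocone (app U (d.ι.app i) s)).whisker
      (inclusion (eventuallyBelow_subset d i s)))).nonempty_congr

end FibCocone

end GroupSystem

/-! ### Sequences and suprema -/

/-- A cocone on a sequence in a poset is a colimit if and only if its vertex is the supremum. -/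
theorem nonempty_isColimit_iff_isLUB {S : Type u} [Preorder S] {X : ℕ ⥤ S} (c : Cocone X) :
    Nonempty (IsColimit c) ↔ IsLUB (Set.range X.obj) c.pt := by
  constructor
  · rintro ⟨hc⟩
    refine ⟨?_, fun b hb => leOfHom (hc.desc ⟨b, { app := fun n => homOfLE (hb ⟨n, rfl⟩) }⟩)⟩
    rintro _ ⟨n, rfl⟩
    exact leOfHom (c.ι.app n)
  · intro h
    refine ⟨{ desc := fun s => homOfLE (h.2 ?_) }⟩
    rintro _ ⟨n, rfl⟩
    exact leOfHom (s.ι.app n)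

namespace WayBelow

variable {S : Type u} [PartialOrder S] {w x y z : S}

theorem le (h : WayBelow x y) : x ≤ y := by
  obtain ⟨k, hk⟩ := h (fun _ => y) monotone_const y (by simp) le_rfl
  exact hk

theorem trans_le (h : WayBelow x y) (h' : y ≤ z) : WayBelow x z :=
  fun c hc s hs hle => h c hc s hs (h'.trans hle)

theorem le_trans (h : w ≤ x) (h' : WayBelow x y) : WayBelow w y := fun c hc s hs hle => by
  obtain ⟨k, hk⟩ := h' c hc s hs hle
  exact ⟨k, h.trans hk⟩

theorem monotone {x : ℕ → S} (h : ∀ n, WayBelow (x n) (x (n + 1))) : Monotone x :=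
  monotone_nat_of_le_succ fun n => (h n).le

theorem of_isLUB {x : ℕ → S} (h : ∀ n, WayBelow (x n) (x (n + 1)))
    (hs : IsLUB (Set.range x) y) (n : ℕ) : WayBelow (x n) y :=
  (h n).trans_le (hs.1 ⟨n + 1, rfl⟩)

end WayBelow

namespace GroupSystem

variable {C : Type v} [Category.{u} C] {U : C ⥤ PartOrd.{u}}
  {P : ∀ S : C, (U.obj S ⥤ AddCommGrpCat.{u}) → Prop} {J : Type u} [Preorder J]
  {F : J ⥤ GroupSystem U P}

namespace FibCocone

variable {d : Cocone (F ⋙ toBase U P)} {L : FibCocone d} {R : Approximation F}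
  {X : ℕ ⥤ U.obj d.pt} {c : Cocone X}

theorem iUnion_below_subset (c : Cocone X) : ⋃ n, below d (X.obj n) ⊆ below d c.pt :=
  Set.iUnion_subset fun n => below_mono d (leOfHom (c.ι.app n))

/-- A left Kan extension preserves those inductive limits of sequences that are approximated
from below. -/
theorem IsKanExtension.isColimit_mapCocone (hL : L.IsKanExtension)
    (hR : R.Dense (⋃ n, below d (X.obj n)) (below d c.pt)) :
    Nonempty (IsColimit (L.fib.mapCocone c)) := by
  refine ⟨IsColimit.ofExistsUnique fun s => ?_⟩
  have hmem : ∀ x ∈ ⋃ n, below d (X.obj n), ∃ n, x ∈ below d (X.obj n) := fun x hx =>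
    Set.mem_iUnion.1 hx
  have hs : ∀ {m n : ℕ} (h : m ≤ n),
      atLE L.fib (leOfHom (X.map (homOfLE h))) ≫ s.ι.app n = s.ι.app m := fun h =>
    (s.ι.naturality (homOfLE h)).trans (Category.comp_id _)
  have hle : ∀ x (m n : ℕ) (hm : x ∈ below d (X.obj m)) (hn : x ∈ below d (X.obj n)), m ≤ n →
      L.transTo x hm ≫ s.ι.app m = L.transTo x hn ≫ s.ι.app n := fun x m n hm hn h => by
    have h1 := L.transTo_atLE x hm (leOfHom (X.map (homOfLE h)))
    have h2 := hs h
    rw [← h2, ← h1]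
    exact (Category.assoc _ _ _).symm
  have hind : ∀ x (m n : ℕ) (hm : x ∈ below d (X.obj m)) (hn : x ∈ below d (X.obj n)),
      L.transTo x hm ≫ s.ι.app m = L.transTo x hn ≫ s.ι.app n := fun x m n hm hn =>
    (le_total m n).elim (hle x m n hm hn) fun h => (hle x n m hn hm h).symm
  -- A cocone `s` on the `G (x_n)` yields a compatible family on the elements below some `x_n`, which
  -- extends to all elements below the supremum.
  choose N hN using hmem
  let σ : diagram F (⋃ n, below d (X.obj n)) ⟶ (Functor.const _).obj s.pt :=
    diagramHom (fun x hx => L.transTo x (hN x hx) ≫ s.ι.app (N x hx)) fun x y hx hy h e => by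
      have hx' : x ∈ below d (X.obj (N y hy)) := by
        have := hN y hy
        exact (app_push d h x.val).ge.trans ((app_mono U _ e).trans this)
      rw [hind x _ _ (hN x hx) hx', ← L.transport_transTo x y hx' (hN y hy) h e]
      exact (Category.assoc _ _ _).symm
  obtain ⟨τ, hτ⟩ := hR.exists_extension (iUnion_below_subset c) σ
  obtain ⟨hc⟩ := hL c.pt
  have hfac : ∀ x (hx : x ∈ below d c.pt), L.transTo x hx ≫ hc.desc ⟨s.pt, τ⟩ = τ.app ⟨x, hx⟩ :=
    fun x hx => hc.fac ⟨s.pt, τ⟩ ⟨x, hx⟩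
  refine ⟨hc.desc ⟨s.pt, τ⟩, fun n => ?_, fun g hg => ?_⟩
  · obtain ⟨hn⟩ := hL (X.obj n)
    refine hn.hom_ext fun ⟨x, hx⟩ => ?_
    have hxE : x ∈ ⋃ n, below d (X.obj n) := Set.mem_iUnion.2 ⟨n, hx⟩
    have h1 := L.transTo_atLE x hx (leOfHom (c.ι.app n))
    refine (Category.assoc _ _ _).symm.trans ((congrArg (· ≫ hc.desc ⟨s.pt, τ⟩) h1).trans ?_)
    exact (hfac x _).trans ((hτ x hxE).trans (hind x _ _ _ _))
  · have key : (L.belowCocone c.pt).ι ≫ (Functor.const _).map g = τ := by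
      refine hR.hom_ext (iUnion_below_subset c) fun x hx => ?_
      have h1 := L.transTo_atLE x (hN x hx) (leOfHom (c.ι.app (N x hx)))
      have h2 := hg (N x hx)
      refine Eq.trans ?_ (hτ x hx).symm
      change L.transTo x _ ≫ g = L.transTo x (hN x hx) ≫ s.ι.app (N x hx)
      rw [← h1, ← h2]
      exact Category.assoc _ _ _
    exact hc.hom_ext fun x => (NatTrans.congr_app key x).trans (hc.fac ⟨s.pt, τ⟩ x).symm

/-- If the groups `G (x_n)` are those of a left Kan extension, and if `G` preserves the inductive
limit `s` of the sequence `(x_n)`, then `G (s)` is also that of a left Kan extension. -/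
theorem isColimit_belowCocone_of_mapCocone
    (hR : R.Dense (⋃ n, below d (X.obj n)) (below d c.pt))
    (hX : ∀ n, Nonempty (IsColimit (L.belowCocone (X.obj n))))
    (hc : Nonempty (IsColimit (L.fib.mapCocone c))) :
    Nonempty (IsColimit (L.belowCocone c.pt)) := by
  obtain ⟨hc⟩ := hc
  refine ⟨IsColimit.ofExistsUnique fun s => ?_⟩
  have hle : ∀ n, X.obj n ≤ c.pt := fun n => leOfHom (c.ι.app n)
  have key : ∀ n, ∃ f : L.fib.obj (X.obj n) ⟶ s.pt, ∀ x (hx : x ∈ below d (X.obj n)),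
      L.transTo x hx ≫ f = s.ι.app ⟨x, below_mono d (hle n) hx⟩ := fun n => by
    obtain ⟨hn⟩ := hX n
    let t := s.whisker (inclusion (below_mono d (hle n)))
    exact ⟨hn.desc t, fun x hx => hn.fac t ⟨x, hx⟩⟩
  choose f hf using key
  let t : Cocone (X ⋙ L.fib) :=
    { pt := s.pt
      ι :=
        { app := f
          naturality := fun m n h => by
            obtain ⟨hm⟩ := hX m
            refine hm.hom_ext fun ⟨x, hx⟩ => ?_
            have h1 := L.transTo_atLE x hx (leOfHom (X.map h))
            have h2 := hf n x (below_mono d (leOfHom (X.map h)) hx)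
            rw [← h1] at h2
            exact ((Category.assoc _ _ _).symm.trans h2).trans
              ((hf m x hx).symm.trans (congrArg (L.transTo x hx ≫ ·) (Category.comp_id _).symm)) } }
  have hfac : ∀ n, atLE L.fib (hle n) ≫ hc.desc t = f n := hc.fac t
  refine ⟨hc.desc t, ?_, fun g hg => hc.hom_ext fun n => ?_⟩
  · have : (L.belowCocone c.pt).ι ≫ (Functor.const _).map (hc.desc t) = s.ι := by
      refine hR.hom_ext (iUnion_below_subset c) fun x hx => ?_
      obtain ⟨n, hn⟩ := Set.mem_iUnion.1 hx
      have h1 := L.transTo_atLE x hn (hle n)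
      refine Eq.trans ?_ (hf n x hn)
      change L.transTo x _ ≫ hc.desc t = _
      rw [← hfac, ← h1, Category.assoc]
    exact fun x => NatTrans.congr_app this x
  · obtain ⟨hn⟩ := hX n
    refine hn.hom_ext fun ⟨x, hx⟩ => ?_
    have h1 := L.transTo_atLE x hx (hle n)
    have h2 := hg ⟨x, below_mono d (hle n) hx⟩
    change L.transTo x hx ≫ atLE L.fib (hle n) ≫ g =
      L.transTo x hx ≫ atLE L.fib (hle n) ≫ hc.desc t
    rw [hfac, hf, ← h2]
    exact (Category.assoc _ _ _).symm.trans (congrArg (· ≫ g) h1)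

/-- The group at an element is trivial if the groups in the inductive system are. -/
theorem IsAlgebraicLimit.subsingleton (hL : L.IsAlgebraicLimit) {i : J}
    {s : U.obj (F.obj i).base}
    (h : ∀ (j : J) (hj : i ≤ j), Subsingleton ((F.obj j).fib.obj (push F hj s))) :
    Subsingleton (L.fib.obj (app U (d.ι.app i) s)) := by
  obtain ⟨hc⟩ := hL i s
  -- The identity and the zero map agree on the trivial groups of the system, hence they are equal.
  have h0 : 𝟙 (L.fibCocone i s).pt = 0 := hc.hom_ext fun j => by
    have := h j.1 j.2
    ext x
    obtain rfl : x = 0 := Subsingleton.elim (α := (F.obj j.1).fib.obj (push F j.2 s)) _ _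
    rw [map_zero, map_zero]
  refine ⟨fun x y => ?_⟩
  have hx : ∀ x : L.fib.obj (app U (d.ι.app i) s), x = 0 := fun x =>
    congrArg (fun f : (L.fibCocone i s).pt ⟶ (L.fibCocone i s).pt => f.hom x) h0
  rw [hx x, hx y]

end FibCocone

/-! ### Posets and pomonoids -/

variable (F) in
/-- The order as an approximation relation. -/
def orderApproximation : Approximation F where
  rel _ s t := s ≤ t
  le h := h
  trans_le h h' := h.trans h'
  rel_push _ _ _ h := app_mono U _ h
  isColimit i t := by
    refine ⟨IsColimit.ofExistsUnique fun s => ?_⟩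
    refine ⟨s.ι.app ⟨t, le_refl t⟩, fun x => ?_, fun g hg => ?_⟩
    · exact (s.ι.naturality (X := x) (Y := ⟨t, le_refl t⟩) (homOfLE x.2)).trans (Category.comp_id _)
    · refine Eq.trans ?_ (hg ⟨t, le_refl t⟩)
      exact ((congrArg (· ≫ g) (atLE_refl _ _)).trans (Category.id_comp _)).symm

/-- If `S_∞` is, as a poset, the inductive limit of the `S_i`, then the algebraic limits are the left
Kan extensions. -/
theorem FibCocone.isAlgebraicLimit_iff [IsDirectedOrder J] {d : Cocone (F ⋙ toBase U P)}
    (hsurj : ∀ s : U.obj d.pt, ∃ (i : J) (t : U.obj (F.obj i).base), app U (d.ι.app i) t = s)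
    (hle : ∀ (i j : J) (s : U.obj (F.obj i).base) (t : U.obj (F.obj j).base),
      app U (d.ι.app i) s ≤ app U (d.ι.app j) t →
        ∃ (k : J) (hi : i ≤ k) (hj : j ≤ k), push F hi s ≤ push F hj t)
    (L : FibCocone d) : L.IsAlgebraicLimit ↔ L.IsKanExtension := by
  have key : ∀ (i : J) (s : U.obj (F.obj i).base), Nonempty (IsColimit (L.fibCocone i s)) ↔
      Nonempty (IsColimit (L.belowCocone (app U (d.ι.app i) s))) := fun i s => by
    refine L.isColimit_fibCocone_iff (orderApproximation F) i s fun x hx t ht => ?_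
    obtain ⟨k, hj, hi, h⟩ := hle x.idx i t s ((app_mono U _ ht).trans hx)
    exact ⟨k, hi, hj, h⟩
  constructor
  · intro hL s
    obtain ⟨i, t, rfl⟩ := hsurj s
    exact (key i t).1 (hL i t)
  · exact fun hL i s => (key i s).2 (hL _)

/-! ### Cuntz semigroups -/

variable {F : J ⥤ CuGp.{u}}

/-- The way-below relation as an approximation relation on Cuntz semigroups. -/
def wayBelowApproximation (F : J ⥤ CuGp.{u}) : Approximation F where
  rel _ s t := WayBelow s t
  le h := h.le
  trans_le h h' := h.trans_le h'
  rel_push h _ _ hst := CuSemigroup.Hom.map_wayBelow (F.map (homOfLE h)).base hst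
  isColimit i t := by
    obtain ⟨x, hx, hlub⟩ := (F.obj i).base.exists_wayBelow_seq t
    have hmono := WayBelow.monotone hx
    let φ : ℕ ⥤ {s : CuSemigroup.toPartOrd.obj (F.obj i).base | WayBelow s t} :=
      Monotone.functor (f := fun n => ⟨x n, WayBelow.of_isLUB hx hlub n⟩) fun _ _ h => hmono h
    have : φ.Final := by
      refine Functor.final_of_exists_of_isFiltered _ ?_ fun {_ c} _ _ => ⟨c, 𝟙 c, rfl⟩
      rintro ⟨s, hs⟩
      obtain ⟨n, hn⟩ := hs x hmono t hlub le_rfl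
      exact ⟨n, ⟨homOfLE hn⟩⟩
    have := (F.obj i).property.2
    let c : Cocone (φ ⋙ valFunctor {s : CuSemigroup.toPartOrd.obj (F.obj i).base | WayBelow s t}) :=
      { pt := t
        ι := { app := fun n => homOfLE (hlub.1 ⟨n, rfl⟩) } }
    obtain ⟨hc⟩ := (nonempty_isColimit_iff_isLUB c).2 hlub
    exact ⟨Functor.Final.isColimitWhiskerEquiv φ _ (isColimitOfPreserves (F.obj i).fib hc)⟩

end GroupSystem

/-! ### Directed limits of posets and of pomonoids -/

section OrderDirectLimit

variable {ι : Type*} [Preorder ι] [IsDirectedOrder ι] {G : ι → Type*}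
  {T : ∀ ⦃i j : ι⦄, i ≤ j → Type*} {f : ∀ i j (h : i ≤ j), T h}
  [∀ i j (h : i ≤ j), FunLike (T h) (G i) (G j)] [DirectedSystem G (f · · ·)]

variable (G f) in
/-- The direct limit of partially ordered sets. It is a copy of `DirectLimit`, since the latter is
a quotient and as such carries another preorder. -/
def OrderDirectLimit : Type _ := DirectLimit G f

namespace OrderDirectLimit

variable (f) in
/-- The map from a member of the directed system to the direct limit. -/
def mk (i : ι) (x : G i) : OrderDirectLimit G f :=
  (⟦⟨i, x⟩⟧ : DirectLimit G f)

theorem mk_apply {i j : ι} (h : i ≤ j) (x : G i) : mk f j (f i j h x) = mk f i x :=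
  DirectLimit.mk_apply i j x h

theorem exists_mk_eq (z : OrderDirectLimit G f) : ∃ (i : ι) (x : G i), mk f i x = z := by
  obtain ⟨i, x, h⟩ := DirectLimit.exists_eq_mk f z
  exact ⟨i, x, h.symm⟩

theorem eq_of_mk_eq_mk {i j : ι} {x : G i} {y : G j} (h : mk f i x = mk f j y) :
    ∃ (k : ι) (hi : i ≤ k) (hj : j ≤ k), ∀ l (hl : k ≤ l),
      f i l (hi.trans hl) x = f j l (hj.trans hl) y := by
  obtain ⟨k, hi, hj, e⟩ := Quotient.exact h
  refine ⟨k, hi, hj, fun l hl => ?_⟩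
  rw [← DirectedSystem.map_map' f hi hl, ← DirectedSystem.map_map' f hj hl]
  exact congrArg (f k l hl) e

variable [∀ i, PartialOrder (G i)] [∀ i j (h : i ≤ j), OrderHomClass (T h) (G i) (G j)]

/-- Two elements are comparable if representatives of them at some stage are. -/
instance : PartialOrder (OrderDirectLimit G f) where
  le z w := ∃ (i : ι) (x y : G i), z = mk f i x ∧ w = mk f i y ∧ x ≤ y
  le_refl z := by
    obtain ⟨i, x, rfl⟩ := exists_mk_eq z
    exact ⟨i, x, x, rfl, rfl, le_rfl⟩
  le_trans := by
    rintro _ _ _ ⟨i, x, y, rfl, rfl, hxy⟩ ⟨j, y', z, hy, rfl, hyz⟩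
    obtain ⟨k, hi, hj, h⟩ := eq_of_mk_eq_mk hy
    refine ⟨k, f i k hi x, f j k hj z, (mk_apply hi x).symm, (mk_apply hj z).symm, ?_⟩
    exact (OrderHomClass.mono (f i k hi) hxy).trans
      ((h k le_rfl).le.trans (OrderHomClass.mono (f j k hj) hyz))
  le_antisymm := by
    rintro _ _ ⟨i, x, y, rfl, rfl, hxy⟩ ⟨j, y', x', hy, hx, hyx⟩
    obtain ⟨k, hi, hj, h⟩ := eq_of_mk_eq_mk hy
    obtain ⟨l, _, _, h'⟩ := eq_of_mk_eq_mk hx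
    obtain ⟨m, hk, hl⟩ := exists_ge_ge k l
    rw [← mk_apply (hi.trans hk) x, ← mk_apply (hi.trans hk) y]
    refine congrArg (mk f m) (le_antisymm (OrderHomClass.mono _ hxy) ?_)
    rw [h m hk, h' m hl]
    exact OrderHomClass.mono _ hyx

theorem mk_mono {i : ι} {x y : G i} (h : x ≤ y) : mk f i x ≤ mk f i y :=
  ⟨i, x, y, rfl, rfl, h⟩

theorem mk_le_mk {i j : ι} {x : G i} {y : G j} :
    mk f i x ≤ mk f j y ↔
      ∃ (k : ι) (hi : i ≤ k) (hj : j ≤ k), f i k hi x ≤ f j k hj y := by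
  constructor
  · rintro ⟨k, x', y', hx, hy, h⟩
    obtain ⟨l, hi, _, e⟩ := eq_of_mk_eq_mk hx
    obtain ⟨m, hj, _, e'⟩ := eq_of_mk_eq_mk hy
    obtain ⟨n, hl, hm⟩ := exists_ge_ge l m
    refine ⟨n, hi.trans hl, hj.trans hm, ?_⟩
    rw [e n hl, e' n hm]
    exact OrderHomClass.mono _ h
  · rintro ⟨k, hi, hj, h⟩
    exact ⟨k, _, _, (mk_apply hi x).symm, (mk_apply hj y).symm, h⟩

end OrderDirectLimit

end OrderDirectLimit

section

variable {J : Type u} [Preorder J]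

namespace PartOrd

variable (F : J ⥤ PartOrd.{u})

/-- The connecting maps of an inductive system of posets. -/
def mapLE (i j : J) (h : i ≤ j) : F.obj i →o F.obj j := (F.map (homOfLE h)).hom

instance directedSystem : DirectedSystem (fun i => F.obj i) (mapLE F · · ·) where
  map_self i x := congrArg (fun f : F.obj i ⟶ F.obj i => f.hom x) (F.map_id i)
  map_map k _ i hij hjk x :=
    congrArg (fun f : F.obj i ⟶ F.obj k => f.hom x) (F.map_comp (homOfLE hij) (homOfLE hjk)).symm

variable [IsDirectedOrder J]

/-- The inductive limit of posets. -/
def directLimitCocone : Cocone F where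
  pt := PartOrd.of (OrderDirectLimit (fun i => F.obj i) (mapLE F))
  ι :=
    { app := fun i => PartOrd.ofHom
        { toFun := fun x => OrderDirectLimit.mk (mapLE F) i x
          monotone' := fun _ _ h => OrderDirectLimit.mk_mono h }
      naturality := fun i j h => by
        ext x
        exact OrderDirectLimit.mk_apply (f := mapLE F) (leOfHom h) x }

theorem isColimit_directLimitCocone : Nonempty (IsColimit (directLimitCocone F)) := by
  refine ⟨IsColimit.ofExistsUnique fun s => ?_⟩
  have hs : ∀ (i j : J) (h : i ≤ j) (x : F.obj i),
      (s.ι.app i).hom x = (s.ι.app j).hom (mapLE F i j h x) := fun i j h x =>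
    congrArg (fun f : F.obj i ⟶ s.pt => f.hom x) (s.w (homOfLE h)).symm
  refine ⟨PartOrd.ofHom
    { toFun := DirectLimit.lift (mapLE F) (fun i x => (s.ι.app i).hom x) hs
      monotone' := ?_ }, fun i => rfl, fun g hg => ?_⟩
  · rintro _ _ ⟨i, x, y, rfl, rfl, h⟩
    exact (s.ι.app i).hom.monotone h
  · ext x
    obtain ⟨i, x, rfl⟩ := OrderDirectLimit.exists_mk_eq x
    exact congrArg (fun f : F.obj i ⟶ s.pt => f.hom x) (hg i)

end PartOrd

namespace PoM

variable (F : J ⥤ PoM.{u})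

/-- The connecting maps of an inductive system of pomonoids. -/
def mapLE (i j : J) (h : i ≤ j) : F.obj i →+o F.obj j := F.map (homOfLE h)

instance directedSystem : DirectedSystem (fun i => F.obj i) (mapLE F · · ·) where
  map_self i x := congrArg (fun f : F.obj i →+o F.obj i => f x) (F.map_id i)
  map_map k _ i hij hjk x :=
    congrArg (fun f : F.obj i →+o F.obj k => f x) (F.map_comp (homOfLE hij) (homOfLE hjk)).symm

variable [IsDirectedOrder J] [Nonempty J]

noncomputable instance :
    AddCommMonoid (OrderDirectLimit (fun i => (F.obj i).carrier) (mapLE F)) :=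
  inferInstanceAs (AddCommMonoid (DirectLimit (fun i => (F.obj i).carrier) (mapLE F)))

theorem mk_add {i : J} (x y : F.obj i) :
    OrderDirectLimit.mk (mapLE F) i (x + y) =
      OrderDirectLimit.mk (mapLE F) i x + OrderDirectLimit.mk (mapLE F) i y :=
  (DirectLimit.add_def (G := fun i => (F.obj i).carrier) (f := mapLE F) i x y).symm

theorem mk_zero (i : J) : OrderDirectLimit.mk (mapLE F) i (0 : F.obj i) = 0 :=
  (DirectLimit.zero_def (f := mapLE F) i).symm

/-- The inductive limit of pomonoids. -/
noncomputable def directLimit : PoM.{u} where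
  carrier := OrderDirectLimit (fun i => (F.obj i).carrier) (mapLE F)
  isOrderedAddMonoid :=
    { add_le_add_left := by
        rintro _ _ ⟨i, x, y, rfl, rfl, h⟩ c
        obtain ⟨j, c, rfl⟩ := OrderDirectLimit.exists_mk_eq c
        obtain ⟨k, hi, hj⟩ := exists_ge_ge i j
        rw [← OrderDirectLimit.mk_apply (f := mapLE F) hi x,
          ← OrderDirectLimit.mk_apply (f := mapLE F) hi y,
          ← OrderDirectLimit.mk_apply (f := mapLE F) hj c, ← mk_add, ← mk_add]
        exact OrderDirectLimit.mk_mono (add_le_add_left (OrderHomClass.mono _ h) _) }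
  zero_le x := by
    obtain ⟨i, x, rfl⟩ := OrderDirectLimit.exists_mk_eq x
    rw [← mk_zero F i]
    exact OrderDirectLimit.mk_mono ((F.obj i).zero_le x)

/-- The morphism from a member of an inductive system of pomonoids to the inductive limit. -/
noncomputable def toDirectLimit (i : J) : F.obj i →+o directLimit F where
  toFun x := OrderDirectLimit.mk (mapLE F) i x
  map_zero' := mk_zero F i
  map_add' x y := mk_add F x y
  monotone' _ _ h := OrderDirectLimit.mk_mono h

theorem toDirectLimit_map {i j : J} (h : i ≤ j) (x : F.obj i) :
    toDirectLimit F j (mapLE F i j h x) = toDirectLimit F i x :=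
  OrderDirectLimit.mk_apply (G := fun i => (F.obj i).carrier) (f := mapLE F) h x

theorem exists_toDirectLimit_eq (x : directLimit F) :
    ∃ (i : J) (s : F.obj i), toDirectLimit F i s = x :=
  OrderDirectLimit.exists_mk_eq x

theorem toDirectLimit_le_iff {i j : J} {x : F.obj i} {y : F.obj j} :
    toDirectLimit F i x ≤ toDirectLimit F j y ↔
      ∃ (k : J) (hi : i ≤ k) (hj : j ≤ k), mapLE F i k hi x ≤ mapLE F j k hj y :=
  OrderDirectLimit.mk_le_mk

/-- The cocone of the inductive limit of pomonoids. -/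
noncomputable def directLimitCocone : Cocone F where
  pt := directLimit F
  ι :=
    { app := toDirectLimit F
      naturality := fun _ _ h => OrderAddMonoidHom.ext fun x => toDirectLimit_map F (leOfHom h) x }

theorem isColimit_directLimitCocone : Nonempty (IsColimit (directLimitCocone F)) := by
  refine ⟨IsColimit.ofExistsUnique fun s => ?_⟩
  let e : ∀ i, F.obj i →+o s.pt := s.ι.app
  have hs : ∀ (i j : J) (h : i ≤ j) (x : F.obj i), e i x = e j (mapLE F i j h x) :=
    fun i j h x => congrArg (fun f : F.obj i →+o s.pt => f x) (s.w (homOfLE h)).symm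
  let m : directLimit F →+o s.pt :=
    { toFun := DirectLimit.lift (mapLE F) (fun i x => e i x) hs
      map_zero' := DirectLimit.lift_zero e hs
      map_add' := DirectLimit.lift_add e hs
      monotone' := by
        rintro _ _ ⟨i, x, y, rfl, rfl, h⟩
        exact OrderHomClass.mono (e i) h }
  refine ⟨m, fun i => rfl, fun g hg => OrderAddMonoidHom.ext fun x => ?_⟩
  obtain ⟨i, x, rfl⟩ := exists_toDirectLimit_eq F x
  exact congrArg (fun f : F.obj i →+o s.pt => f x) (hg i)

end PoM

end

/-! ### Completion of pomonoids with an auxiliary relation -/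

/-- An auxiliary relation `a ≺ b` on a pomonoid that has the properties of the way-below relation of
a Cuntz semigroup, except that increasing sequences need not have suprema. -/
structure AuxiliaryRelation (A : PoM.{u}) where
  rel : A → A → Prop
  le {a b : A} : rel a b → a ≤ b
  le_rel_le {a b c d : A} : a ≤ b → rel b c → c ≤ d → rel a d
  exists_seq (a : A) : ∃ x : ℕ → A, (∀ n, rel (x n) (x (n + 1))) ∧ (∀ n, rel (x n) a) ∧
    ∀ b, rel b a → ∃ n, b ≤ x n
  add {a a' b b' : A} : rel a' a → rel b' b → rel (a' + b') (a + b)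
  exists_add {a b c : A} : rel c (a + b) → ∃ a' b', rel a' a ∧ rel b' b ∧ c ≤ a' + b'

namespace AuxiliaryRelation

variable {A : PoM.{u}} (W : AuxiliaryRelation A)

theorem exists_between {a b : A} (h : W.rel a b) : ∃ c, W.rel a c ∧ W.rel c b := by
  obtain ⟨x, hx, hxb, hcof⟩ := W.exists_seq b
  obtain ⟨n, hn⟩ := hcof a h
  exact ⟨x (n + 1), W.le_rel_le hn (hx n) le_rfl, hxb _⟩

theorem rel_zero : W.rel 0 0 := by
  obtain ⟨x, -, hx, -⟩ := W.exists_seq 0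
  exact W.le_rel_le (A.zero_le _) (hx 0) le_rfl

/-- The countably generated round ideals: lower sets that contain, with any two elements, an element
to which both are related, and that have a countable cofinal subset. -/
@[ext]
structure RoundIdeal where
  carrier : Set A
  mem_of_le {a b : A} : a ≤ b → b ∈ carrier → a ∈ carrier
  round {a b : A} : a ∈ carrier → b ∈ carrier → ∃ c ∈ carrier, W.rel a c ∧ W.rel b c
  countable : ∃ x : ℕ → A, (∀ n, x n ∈ carrier) ∧ ∀ a ∈ carrier, ∃ n, a ≤ x n

namespace RoundIdeal

variable {W}

instance : Membership A W.RoundIdeal := ⟨fun I a => a ∈ I.carrier⟩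

instance : PartialOrder W.RoundIdeal :=
  PartialOrder.lift RoundIdeal.carrier fun _ _ => RoundIdeal.ext

theorem ext_mem {I J : W.RoundIdeal} (h : ∀ a, a ∈ I ↔ a ∈ J) : I = J :=
  RoundIdeal.ext (Set.ext h)

theorem zero_mem (I : W.RoundIdeal) : 0 ∈ I := by
  obtain ⟨x, hx, -⟩ := I.countable
  exact I.mem_of_le (A.zero_le _) (hx 0)

theorem exists_rel {I : W.RoundIdeal} {a : A} (ha : a ∈ I) : ∃ b ∈ I, W.rel a b := by
  obtain ⟨b, hb, h, -⟩ := I.round ha ha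
  exact ⟨b, hb, h⟩

/-- Every countably generated round ideal is generated by a `≺`-increasing sequence. -/
theorem exists_seq (I : W.RoundIdeal) : ∃ x : ℕ → A, (∀ n, W.rel (x n) (x (n + 1))) ∧
    (∀ n, x n ∈ I) ∧ ∀ a ∈ I, ∃ n, a ≤ x n := by
  obtain ⟨y, hy, hcof⟩ := I.countable
  have step : ∀ (a : {a // a ∈ I}) (n : ℕ), ∃ b : {a // a ∈ I}, W.rel a b ∧ W.rel (y n) b :=
    fun a n => by
      obtain ⟨b, hb, h⟩ := I.round a.2 (hy n)
      exact ⟨⟨b, hb⟩, h⟩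
  choose g hg using step
  -- Each term is related to the next one, which also dominates a further term of the cofinal
  -- sequence `y`.
  let x : ℕ → {a // a ∈ I} := fun n => Nat.rec ⟨y 0, hy 0⟩ (fun n a => g a n) n
  refine ⟨fun n => (x n).1, fun n => (hg (x n) n).1, fun n => (x n).2, fun a ha => ?_⟩
  obtain ⟨n, hn⟩ := hcof a ha
  exact ⟨n + 1, hn.trans (W.le (hg (x n) n).2)⟩

/-- The ideal of all elements that are related to a given one. -/
def principal (W : AuxiliaryRelation A) (a : A) : W.RoundIdeal where
  carrier := {b | W.rel b a}
  mem_of_le h h' := W.le_rel_le h h' le_rfl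
  round {b c} hb hc := by
    obtain ⟨x, hx, hxa, hcof⟩ := W.exists_seq a
    have hmono : Monotone x := monotone_nat_of_le_succ fun n => W.le (hx n)
    obtain ⟨m, hm⟩ := hcof b hb
    obtain ⟨n, hn⟩ := hcof c hc
    have h : W.rel (x (max m n)) (x (max m n + 1)) := hx _
    exact ⟨x (max m n + 1), hxa _, W.le_rel_le (hm.trans (hmono (le_max_left _ _))) h le_rfl,
      W.le_rel_le (hn.trans (hmono (le_max_right _ _))) h le_rfl⟩
  countable := by
    obtain ⟨x, -, hxa, hcof⟩ := W.exists_seq a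
    exact ⟨x, hxa, hcof⟩

instance : Add W.RoundIdeal where
  add I J :=
    { carrier := {c | ∃ a ∈ I, ∃ b ∈ J, c ≤ a + b}
      mem_of_le := fun h ⟨a, ha, b, hb, h'⟩ => ⟨a, ha, b, hb, h.trans h'⟩
      round := by
        rintro c c' ⟨a, ha, b, hb, h⟩ ⟨a', ha', b', hb', h'⟩
        obtain ⟨p, hp, hap, hap'⟩ := I.round ha ha'
        obtain ⟨q, hq, hbq, hbq'⟩ := J.round hb hb'
        exact ⟨p + q, ⟨p, hp, q, hq, le_rfl⟩, W.le_rel_le h (W.add hap hbq) le_rfl,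
          W.le_rel_le h' (W.add hap' hbq') le_rfl⟩
      countable := by
        obtain ⟨x, hx, hxI⟩ := I.countable
        obtain ⟨y, hy, hyJ⟩ := J.countable
        refine ⟨fun n => x n.unpair.1 + y n.unpair.2,
          fun n => ⟨_, hx _, _, hy _, le_rfl⟩, ?_⟩
        rintro c ⟨a, ha, b, hb, h⟩
        obtain ⟨m, hm⟩ := hxI a ha
        obtain ⟨n, hn⟩ := hyJ b hb
        refine ⟨Nat.pair m n, h.trans ?_⟩
        simp only [Nat.unpair_pair]
        exact add_le_add hm hn }

instance : Zero W.RoundIdeal where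
  zero :=
    { carrier := {c | c ≤ 0}
      mem_of_le := fun h h' => h.trans h'
      round := fun h h' =>
        ⟨0, le_rfl, W.le_rel_le h W.rel_zero le_rfl, W.le_rel_le h' W.rel_zero le_rfl⟩
      countable := ⟨fun _ => 0, fun _ => le_rfl, fun _ h => ⟨0, h⟩⟩ }

theorem mem_zero {c : A} : c ∈ (0 : W.RoundIdeal) ↔ c ≤ 0 := Iff.rfl

theorem add_comm' (I J : W.RoundIdeal) : I + J = J + I :=
  ext_mem fun _ =>
    ⟨fun ⟨a, ha, b, hb, h⟩ => ⟨b, hb, a, ha, h.trans (add_comm a b).le⟩,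
      fun ⟨a, ha, b, hb, h⟩ => ⟨b, hb, a, ha, h.trans (add_comm a b).le⟩⟩

theorem zero_add' (I : W.RoundIdeal) : 0 + I = I :=
  ext_mem fun c =>
    ⟨fun ⟨_, ha, b, hb, h⟩ =>
        I.mem_of_le (h.trans ((add_le_add_left (mem_zero.1 ha) b).trans (zero_add b).le)) hb,
      fun hc => ⟨0, zero_mem _, c, hc, (zero_add c).ge⟩⟩

instance : AddCommMonoid W.RoundIdeal where
  add_assoc I J K := ext_mem fun c => by
    constructor
    · rintro ⟨a, ⟨p, hp, q, hq, h⟩, b, hb, h'⟩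
      refine ⟨p, hp, q + b, ⟨q, hq, b, hb, le_rfl⟩, h'.trans ?_⟩
      rw [← add_assoc]
      exact add_le_add_left h b
    · rintro ⟨p, hp, a, ⟨q, hq, b, hb, h⟩, h'⟩
      refine ⟨p + q, ⟨p, hp, q, hq, le_rfl⟩, b, hb, h'.trans ?_⟩
      rw [add_assoc]
      exact add_le_add_right h p
  zero_add := zero_add'
  add_zero I := (add_comm' I 0).trans (zero_add' I)
  add_comm := add_comm'
  nsmul := nsmulRec

instance : IsOrderedAddMonoid W.RoundIdeal where
  add_le_add_left _ _ h _ := fun _ ⟨a, ha, b, hb, h'⟩ => ⟨a, h ha, b, hb, h'⟩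

theorem principal_add (a b : A) : principal W (a + b) = principal W a + principal W b :=
  ext_mem fun c => by
    constructor
    · intro h
      obtain ⟨a', b', ha, hb, h'⟩ := W.exists_add h
      exact ⟨a', ha, b', hb, h'⟩
    · rintro ⟨a', ha, b', hb, h⟩
      exact W.le_rel_le h (W.add ha hb) le_rfl

theorem principal_zero : principal W 0 = 0 :=
  ext_mem fun _ => ⟨fun h => W.le h, fun h => W.le_rel_le h W.rel_zero le_rfl⟩

theorem principal_mono {a b : A} (h : a ≤ b) : principal W a ≤ principal W b :=
  fun _ hc => W.le_rel_le le_rfl hc h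

/-- The union of an increasing sequence of ideals. -/
def iUnion (K : ℕ → W.RoundIdeal) (hK : Monotone K) : W.RoundIdeal where
  carrier := {a | ∃ n, a ∈ K n}
  mem_of_le h := fun ⟨n, hn⟩ => ⟨n, (K n).mem_of_le h hn⟩
  round := by
    rintro a b ⟨m, hm⟩ ⟨n, hn⟩
    obtain ⟨c, hc, h⟩ := (K (max m n)).round (hK (le_max_left m n) hm) (hK (le_max_right m n) hn)
    exact ⟨c, ⟨_, hc⟩, h⟩
  countable := by
    choose x hx hcof using fun n => (K n).countable
    refine ⟨fun n => x n.unpair.1 n.unpair.2, fun n => ⟨_, hx _ _⟩, ?_⟩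
    rintro a ⟨m, hm⟩
    obtain ⟨n, hn⟩ := hcof m a hm
    refine ⟨Nat.pair m n, ?_⟩
    simp only [Nat.unpair_pair]
    exact hn

theorem isLUB_iUnion (K : ℕ → W.RoundIdeal) (hK : Monotone K) :
    IsLUB (Set.range K) (iUnion K hK) := by
  refine ⟨?_, fun I hI a ⟨n, hn⟩ => hI ⟨n, rfl⟩ hn⟩
  rintro _ ⟨n, rfl⟩
  exact fun a ha => ⟨n, ha⟩

/-- Suprema of increasing sequences of ideals are unions. -/
theorem isLUB_iff {K : ℕ → W.RoundIdeal} (hK : Monotone K) {I : W.RoundIdeal} :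
    IsLUB (Set.range K) I ↔ ∀ a, a ∈ I ↔ ∃ n, a ∈ K n := by
  constructor
  · intro h a
    rw [h.unique (isLUB_iUnion K hK)]
    rfl
  · intro h
    rw [show I = iUnion K hK from ext_mem h]
    exact isLUB_iUnion K hK

theorem isLUB_principal {I : W.RoundIdeal} {x : ℕ → A} (hx : ∀ n, W.rel (x n) (x (n + 1)))
    (hI : ∀ n, x n ∈ I) (hcof : ∀ a ∈ I, ∃ n, a ≤ x n) :
    IsLUB (Set.range fun n => principal W (x n)) I := by
  refine (isLUB_iff (monotone_nat_of_le_succ fun n => principal_mono (W.le (hx n)))).2 fun a => ?_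
  constructor
  · intro ha
    obtain ⟨n, hn⟩ := hcof a ha
    exact ⟨n + 1, W.le_rel_le hn (hx n) le_rfl⟩
  · rintro ⟨n, hn⟩
    exact I.mem_of_le (W.le hn) (hI n)

theorem wayBelow_iff {I J : W.RoundIdeal} : WayBelow I J ↔ ∃ b ∈ J, ∀ a ∈ I, a ≤ b := by
  constructor
  · intro h
    obtain ⟨x, hx, hJ, hcof⟩ := J.exists_seq
    obtain ⟨n, hn⟩ := h _ (monotone_nat_of_le_succ fun n => principal_mono (W.le (hx n))) J
      (isLUB_principal hx hJ hcof) le_rfl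
    exact ⟨x n, hJ n, fun a ha => W.le (hn ha)⟩
  · rintro ⟨b, hb, h⟩ K hK S hS hJS
    obtain ⟨n, hn⟩ := ((isLUB_iff hK).1 hS b).1 (hJS hb)
    exact ⟨n, fun a ha => (K n).mem_of_le (h a ha) hn⟩

theorem wayBelow_principal {a b : A} (h : W.rel a b) :
    WayBelow (principal W a) (principal W b) :=
  wayBelow_iff.2 ⟨a, h, fun _ hc => W.le hc⟩

theorem exists_wayBelow_seq (I : W.RoundIdeal) : ∃ x : ℕ → A,
    (∀ n, WayBelow (principal W (x n)) (principal W (x (n + 1)))) ∧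
      IsLUB (Set.range fun n => principal W (x n)) I := by
  obtain ⟨x, hx, hI, hcof⟩ := I.exists_seq
  exact ⟨x, fun n => wayBelow_principal (hx n), isLUB_principal hx hI hcof⟩

end RoundIdeal

open RoundIdeal

/-- The completion of a pomonoid with an auxiliary relation is the Cuntz semigroup of its countably
generated round ideals. -/
def completion : CuSemigroup.{u} where
  carrier := W.RoundIdeal
  zero_le I := fun _ ha => I.mem_of_le ha I.zero_mem
  exists_isLUB K hK := ⟨_, isLUB_iUnion K hK⟩
  exists_wayBelow_seq I := by
    obtain ⟨x, hx, hI⟩ := exists_wayBelow_seq I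
    exact ⟨_, hx, hI⟩
  wayBelow_add {I' I J' J} h h' := by
    obtain ⟨b, hb, hI⟩ := wayBelow_iff.1 h
    obtain ⟨c, hc, hJ⟩ := wayBelow_iff.1 h'
    refine wayBelow_iff.2 ⟨b + c, ⟨b, hb, c, hc, le_rfl⟩, ?_⟩
    rintro a ⟨p, hp, q, hq, ha⟩
    exact ha.trans (add_le_add (hI p hp) (hJ q hq))
  isLUB_add x y s t hx hy hs ht := by
    refine (isLUB_iff fun m n h => add_le_add (hx h) (hy h)).2 fun c => ?_
    rw [isLUB_iff hx] at hs
    rw [isLUB_iff hy] at ht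
    constructor
    · rintro ⟨a, ha, b, hb, h⟩
      obtain ⟨m, hm⟩ := (hs a).1 ha
      obtain ⟨n, hn⟩ := (ht b).1 hb
      exact ⟨max m n, a, hx (le_max_left m n) hm, b, hy (le_max_right m n) hn, h⟩
    · rintro ⟨n, a, ha, b, hb, h⟩
      exact ⟨a, (hs a).2 ⟨n, ha⟩, b, (ht b).2 ⟨n, hb⟩, h⟩

variable {W}

theorem isLUB_image_iff {T : PoM.{u}} (φ : A →+o T) {I : W.RoundIdeal} {x : ℕ → A}
    (hI : ∀ n, x n ∈ I) (hcof : ∀ a ∈ I, ∃ n, a ≤ x n) {s : T} :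
    IsLUB (φ '' I.carrier) s ↔ IsLUB (Set.range fun n => φ (x n)) s := by
  have : upperBounds (φ '' I.carrier) = upperBounds (Set.range fun n => φ (x n)) := by
    ext b
    constructor
    · rintro h _ ⟨n, rfl⟩
      exact h ⟨x n, hI n, rfl⟩
    · rintro h _ ⟨a, ha, rfl⟩
      obtain ⟨n, hn⟩ := hcof a ha
      exact (OrderHomClass.mono φ hn).trans (h ⟨n, rfl⟩)
  rw [IsLUB, IsLUB, this]

/-- A homomorphism to a Cuntz semigroup that maps the auxiliary relation to the way-below relation
extends to the completion, by `I ↦ sup φ (I)`. -/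
theorem exists_extension {T : CuSemigroup.{u}} (φ : A →+o T)
    (hφ : ∀ a b, W.rel a b → WayBelow (φ a) (φ b)) :
    ∃ Φ : CuSemigroup.Hom W.completion T,
      ∀ I : W.RoundIdeal, IsLUB (φ '' I.carrier) (Φ.toHom I) := by
  have hmono : ∀ {x : ℕ → A}, (∀ n, W.rel (x n) (x (n + 1))) → Monotone fun n => φ (x n) :=
    fun hx => monotone_nat_of_le_succ fun n => (hφ _ _ (hx n)).le
  have key : ∀ I : W.RoundIdeal, ∃ s : T, IsLUB (φ '' I.carrier) s := fun I => by
    obtain ⟨x, hx, hI, hcof⟩ := I.exists_seq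
    obtain ⟨s, hs⟩ := T.exists_isLUB _ (hmono hx)
    exact ⟨s, (isLUB_image_iff φ hI hcof).2 hs⟩
  choose Φ hΦ using key
  have hle : ∀ {I : W.RoundIdeal} {a : A}, a ∈ I → φ a ≤ Φ I := fun ha => (hΦ _).1 ⟨_, ha, rfl⟩
  have hΦmono : Monotone Φ := fun I J h => (hΦ I).2 (by
    rintro _ ⟨a, ha, rfl⟩
    exact hle (h ha))
  have hzero : Φ 0 = 0 := by
    refine le_antisymm ((hΦ 0).2 ?_) (T.zero_le _)
    rintro _ ⟨a, ha, rfl⟩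
    exact (OrderHomClass.mono φ (RoundIdeal.mem_zero.1 ha)).trans (map_zero φ).le
  have hadd : ∀ I J : W.RoundIdeal, Φ (I + J) = Φ I + Φ J := fun I J => by
    obtain ⟨x, hx, hI, hxI⟩ := I.exists_seq
    obtain ⟨y, hy, hJ, hyJ⟩ := J.exists_seq
    have hxm : Monotone x := monotone_nat_of_le_succ fun n => W.le (hx n)
    have hym : Monotone y := monotone_nat_of_le_succ fun n => W.le (hy n)
    have hcof : ∀ a ∈ I + J, ∃ n, a ≤ x n + y n := by
      rintro c ⟨a, ha, b, hb, h⟩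
      obtain ⟨m, hm⟩ := hxI a ha
      obtain ⟨n, hn⟩ := hyJ b hb
      exact ⟨max m n, h.trans (add_le_add (hm.trans (hxm (le_max_left m n)))
        (hn.trans (hym (le_max_right m n))))⟩
    have h1 := (isLUB_image_iff φ (I := I + J) (x := fun n => x n + y n)
      (fun n => ⟨_, hI n, _, hJ n, le_rfl⟩) hcof).1 (hΦ (I + J))
    have h2 := T.isLUB_add _ _ _ _ (hmono hx) (hmono hy)
      ((isLUB_image_iff φ hI hxI).1 (hΦ I)) ((isLUB_image_iff φ hJ hyJ).1 (hΦ J))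
    simp only [map_add] at h1
    exact h1.unique h2
  let Ψ : W.completion →+o T :=
    { toFun := Φ
      map_zero' := hzero
      map_add' := hadd
      monotone' := hΦmono }
  refine ⟨{ toHom := Ψ, map_wayBelow := fun {I J} h => ?_, map_isLUB := fun K I hK hI => ?_ }, hΦ⟩
  · obtain ⟨b, hb, hI⟩ := wayBelow_iff.1 h
    obtain ⟨c, hc, hbc⟩ := RoundIdeal.exists_rel hb
    have h1 : Φ I ≤ φ b := (hΦ I).2 (by
      rintro _ ⟨a, ha, rfl⟩
      exact OrderHomClass.mono φ (hI a ha))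
    exact WayBelow.le_trans h1 ((hφ b c hbc).trans_le (hle hc))
  · refine ⟨?_, fun b hb => (hΦ I).2 ?_⟩
    · rintro _ ⟨n, rfl⟩
      exact hΦmono (hI.1 ⟨n, rfl⟩)
    · rintro _ ⟨a, ha, rfl⟩
      obtain ⟨n, hn⟩ := ((isLUB_iff hK).1 hI a).1 ha
      exact (hle hn).trans (hb ⟨n, rfl⟩)

end AuxiliaryRelation

/-! ### Directed limits of Cuntz semigroups -/

namespace CuSemigroup

/-- The functor that forgets the axioms (O1) to (O4). -/
def forgetToPoM : CuSemigroup.{u} ⥤ PoM.{u} where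
  obj S := S.toPoM
  map f := Hom.toHom f

variable {J : Type u} [Preorder J] (F : J ⥤ CuSemigroup.{u})

/-- The connecting maps of an inductive system of Cuntz semigroups. -/
def mapLE (i j : J) (h : i ≤ j) : Hom (F.obj i) (F.obj j) := F.map (homOfLE h)

variable [IsDirectedOrder J] [Nonempty J]

/-- The inductive limit, as pomonoids, of an inductive system of Cuntz semigroups. -/
noncomputable abbrev algebraicLimit : PoM.{u} := PoM.directLimit (F ⋙ forgetToPoM)

/-- The morphism from a member of an inductive system of Cuntz semigroups to the algebraic limit. -/
noncomputable def toAlgebraicLimit (i : J) : F.obj i →+o algebraicLimit F :=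
  PoM.toDirectLimit (F ⋙ forgetToPoM) i

variable {F}

theorem toAlgebraicLimit_map {i j : J} (h : i ≤ j) (x : F.obj i) :
    toAlgebraicLimit F j ((mapLE F i j h).toHom x) = toAlgebraicLimit F i x :=
  PoM.toDirectLimit_map (F ⋙ forgetToPoM) h x

theorem exists_toAlgebraicLimit_eq (x : algebraicLimit F) :
    ∃ (i : J) (s : F.obj i), toAlgebraicLimit F i s = x :=
  PoM.exists_toDirectLimit_eq (F ⋙ forgetToPoM) x

theorem exists_toAlgebraicLimit_eq₂ (x y : algebraicLimit F) :
    ∃ (i : J) (s t : F.obj i), toAlgebraicLimit F i s = x ∧ toAlgebraicLimit F i t = y := by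
  obtain ⟨i, s, rfl⟩ := exists_toAlgebraicLimit_eq x
  obtain ⟨j, t, rfl⟩ := exists_toAlgebraicLimit_eq y
  obtain ⟨k, hi, hj⟩ := exists_ge_ge i j
  exact ⟨k, _, _, toAlgebraicLimit_map hi s, toAlgebraicLimit_map hj t⟩

theorem toAlgebraicLimit_le_iff {i j : J} {x : F.obj i} {y : F.obj j} :
    toAlgebraicLimit F i x ≤ toAlgebraicLimit F j y ↔
      ∃ (k : J) (hi : i ≤ k) (hj : j ≤ k), (mapLE F i k hi).toHom x ≤ (mapLE F j k hj).toHom y :=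
  PoM.toDirectLimit_le_iff (F ⋙ forgetToPoM)

theorem toAlgebraicLimit_mono {i : J} {x y : F.obj i} (h : x ≤ y) :
    toAlgebraicLimit F i x ≤ toAlgebraicLimit F i y :=
  OrderHomClass.mono (toAlgebraicLimit F i) h

/-- The relation `a ≺ b` on the algebraic limit: at some stage there are `s' ≪ s` such that `a` is
below the class of `s'`, and `b` is above the class of `s`. -/
def limitRel (a b : algebraicLimit F) : Prop :=
  ∃ (i : J) (s' s : F.obj i), WayBelow s' s ∧ a ≤ toAlgebraicLimit F i s' ∧
    toAlgebraicLimit F i s ≤ b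

/-- If `a ≺ s`, then at some later stage `a` is below the class of an element that is way below the
image of `s`. -/
theorem limitRel.exists_wayBelow {a : algebraicLimit F} {i : J} {s : F.obj i}
    (h : limitRel a (toAlgebraicLimit F i s)) :
    ∃ (k : J) (hk : i ≤ k) (t : F.obj k), a ≤ toAlgebraicLimit F k t ∧
      WayBelow t ((mapLE F i k hk).toHom s) := by
  obtain ⟨j, t', t, htt, hat, hts⟩ := h
  obtain ⟨k, hj, hi, hle⟩ := toAlgebraicLimit_le_iff.1 hts
  exact ⟨k, hi, (mapLE F j k hj).toHom t', hat.trans (toAlgebraicLimit_map hj t').ge,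
    ((mapLE F j k hj).map_wayBelow htt).trans_le hle⟩

theorem limitRel_of_wayBelow {i : J} {s' s : F.obj i} (h : WayBelow s' s) :
    limitRel (toAlgebraicLimit F i s') (toAlgebraicLimit F i s) :=
  ⟨i, s', s, h, le_rfl, le_rfl⟩

/-- If `a ≺ s`, and if `s` is the supremum of an increasing sequence in `S_i`, then `a` is below a
term of the sequence. -/
theorem limitRel.exists_le {a : algebraicLimit F} {i : J} {s : F.obj i}
    (h : limitRel a (toAlgebraicLimit F i s)) {x : ℕ → F.obj i} (hx : Monotone x)
    (hs : IsLUB (Set.range x) s) : ∃ n, a ≤ toAlgebraicLimit F i (x n) := by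
  obtain ⟨k, hk, t, hat, ht⟩ := h.exists_wayBelow
  obtain ⟨n, hn⟩ := ht _ (fun _ _ h => OrderHomClass.mono (mapLE F i k hk).toHom (hx h)) _
    ((mapLE F i k hk).map_isLUB x s hx hs) le_rfl
  exact ⟨n, hat.trans ((toAlgebraicLimit_mono hn).trans (toAlgebraicLimit_map hk (x n)).le)⟩

variable (F)

/-- The relation `≺` on the algebraic limit is an auxiliary relation. -/
noncomputable def limitRelation : AuxiliaryRelation (algebraicLimit F) where
  rel := limitRel
  le := fun ⟨_, _, _, h, ha, hb⟩ => ha.trans ((toAlgebraicLimit_mono h.le).trans hb)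
  le_rel_le := fun hab ⟨i, s', s, h, hb, hc⟩ hcd => ⟨i, s', s, h, hab.trans hb, hc.trans hcd⟩
  exists_seq a := by
    obtain ⟨i, s, rfl⟩ := exists_toAlgebraicLimit_eq a
    obtain ⟨x, hx, hs⟩ := (F.obj i).exists_wayBelow_seq s
    exact ⟨fun n => toAlgebraicLimit F i (x n), fun n => limitRel_of_wayBelow (hx n),
      fun n => limitRel_of_wayBelow (WayBelow.of_isLUB hx hs n),
      fun b hb => hb.exists_le (WayBelow.monotone hx) hs⟩
  add := by
    rintro a a' b b' ⟨i, s', s, hs, ha', ha⟩ ⟨j, t', t, ht, hb', hb⟩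
    obtain ⟨k, hi, hj⟩ := exists_ge_ge i j
    rw [← toAlgebraicLimit_map hi] at ha ha'
    rw [← toAlgebraicLimit_map hj] at hb hb'
    refine ⟨k, _, _, (F.obj k).wayBelow_add ((mapLE F i k hi).map_wayBelow hs)
      ((mapLE F j k hj).map_wayBelow ht), ?_, ?_⟩
    · rw [map_add]
      exact add_le_add ha' hb'
    · rw [map_add]
      exact add_le_add ha hb
  exists_add {a b c} h := by
    obtain ⟨i, s, t, rfl, rfl⟩ := exists_toAlgebraicLimit_eq₂ a b
    rw [← map_add] at h
    obtain ⟨x, hx, hs⟩ := (F.obj i).exists_wayBelow_seq s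
    obtain ⟨y, hy, ht⟩ := (F.obj i).exists_wayBelow_seq t
    have hxm := WayBelow.monotone hx
    have hym := WayBelow.monotone hy
    obtain ⟨n, hn⟩ := h.exists_le (fun m n h => add_le_add (hxm h) (hym h))
      ((F.obj i).isLUB_add x y s t hxm hym hs ht)
    refine ⟨_, _, limitRel_of_wayBelow (WayBelow.of_isLUB hx hs n),
      limitRel_of_wayBelow (WayBelow.of_isLUB hy ht n), hn.trans ?_⟩
    rw [map_add]

open AuxiliaryRelation RoundIdeal

/-- The inductive limit of Cuntz semigroups: the completion of the algebraic limit. -/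
noncomputable def directLimit : CuSemigroup.{u} := (limitRelation F).completion

/-- The morphism from a member of an inductive system of Cuntz semigroups to the inductive limit. -/
noncomputable def toDirectLimit (i : J) : Hom (F.obj i) (directLimit F) where
  toHom :=
    { toFun := fun s => principal (limitRelation F) (toAlgebraicLimit F i s)
      map_zero' := (congrArg _ (map_zero (toAlgebraicLimit F i))).trans principal_zero
      map_add' := fun s t =>
        (congrArg _ (map_add (toAlgebraicLimit F i) s t)).trans (principal_add _ _)
      monotone' := fun s t h => principal_mono (toAlgebraicLimit_mono h) }
  map_wayBelow h := wayBelow_principal (limitRel_of_wayBelow h)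
  map_isLUB x s hx hs := by
    refine (isLUB_iff fun m n h => principal_mono (toAlgebraicLimit_mono (hx h))).2 fun a => ?_
    constructor
    · intro ha
      obtain ⟨c, hac, hcs⟩ := (limitRelation F).exists_between ha
      obtain ⟨n, hn⟩ := limitRel.exists_le hcs hx hs
      exact ⟨n, (limitRelation F).le_rel_le le_rfl hac hn⟩
    · rintro ⟨n, hn⟩
      exact (limitRelation F).le_rel_le le_rfl hn (toAlgebraicLimit_mono (hs.1 ⟨n, rfl⟩))

/-- The cocone of the inductive limit of Cuntz semigroups. -/
noncomputable def directLimitCocone : Cocone F where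
  pt := directLimit F
  ι :=
    { app := toDirectLimit F
      naturality := fun _ _ h => Hom.ext (OrderAddMonoidHom.ext fun x =>
        congrArg (principal (limitRelation F)) (toAlgebraicLimit_map (leOfHom h) x)) }

/-- The images of the members of the inductive system are dense in the inductive limit. -/
theorem exists_seq_directLimit (s : directLimit F) :
    ∃ x : ℕ → directLimit F, (∀ n, WayBelow (x n) (x (n + 1))) ∧ IsLUB (Set.range x) s ∧
      ∀ n, ∃ (i : J) (t : F.obj i), x n = (toDirectLimit F i).toHom t := by
  obtain ⟨x, hx, hs⟩ := RoundIdeal.exists_wayBelow_seq (W := limitRelation F) s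
  refine ⟨_, hx, hs, fun n => ?_⟩
  obtain ⟨i, t, h⟩ := exists_toAlgebraicLimit_eq (x n)
  exact ⟨i, t, congrArg _ h.symm⟩

/-- An inequality in the inductive limit of Cuntz semigroups holds at some stage after the left hand
side is replaced by an element way below it. -/
theorem exists_le_of_toDirectLimit_le {i j : J} {s : F.obj i} {t t' : F.obj j}
    (h : (toDirectLimit F j).toHom t ≤ (toDirectLimit F i).toHom s) (ht : WayBelow t' t) :
    ∃ (k : J) (hj : j ≤ k) (hi : i ≤ k),
      (mapLE F j k hj).toHom t' ≤ (mapLE F i k hi).toHom s := by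
  have h1 : limitRel (toAlgebraicLimit F j t') (toAlgebraicLimit F i s) :=
    h (limitRel_of_wayBelow ht)
  exact toAlgebraicLimit_le_iff.1 ((limitRelation F).le h1)

theorem isColimit_directLimitCocone : Nonempty (IsColimit (directLimitCocone F)) := by
  refine ⟨IsColimit.ofExistsUnique fun c => ?_⟩
  let e : ∀ i, Hom (F.obj i) c.pt := c.ι.app
  obtain ⟨hA⟩ := PoM.isColimit_directLimitCocone (F ⋙ forgetToPoM)
  let φ : algebraicLimit F →+o c.pt := hA.desc (forgetToPoM.mapCocone c)
  have hφ : ∀ (i : J) (s : F.obj i), φ (toAlgebraicLimit F i s) = (e i).toHom s := fun i s =>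
    congrArg (fun f : F.obj i →+o c.pt => f s) (hA.fac (forgetToPoM.mapCocone c) i)
  obtain ⟨Φ, hΦ⟩ := exists_extension (W := limitRelation F) φ (by
    rintro a b ⟨i, s', s, h, ha, hb⟩
    refine WayBelow.le_trans (OrderHomClass.mono φ ha)
      (WayBelow.trans_le ?_ (OrderHomClass.mono φ hb))
    rw [hφ, hφ]
    exact (e i).map_wayBelow h)
  have hfac : ∀ (i : J) (s : F.obj i),
      Φ.toHom ((toDirectLimit F i).toHom s) = (e i).toHom s := fun i s => by
    obtain ⟨x, hx, hs⟩ := (F.obj i).exists_wayBelow_seq s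
    have hxm := WayBelow.monotone hx
    have h1 := (isLUB_image_iff φ (I := principal (limitRelation F) (toAlgebraicLimit F i s))
      (x := fun n => toAlgebraicLimit F i (x n))
      (fun n => limitRel_of_wayBelow (WayBelow.of_isLUB hx hs n))
      (fun a ha => limitRel.exists_le ha hxm hs)).1 (hΦ _)
    simp only [hφ] at h1
    exact h1.unique ((e i).map_isLUB x s hxm hs)
  refine ⟨Φ, fun i => Hom.ext (OrderAddMonoidHom.ext (hfac i)), fun (g : Hom _ _) hg => ?_⟩
  have hg' : ∀ (i : J) (s : F.obj i), g.toHom ((toDirectLimit F i).toHom s) = (e i).toHom s :=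
    fun i s => congrArg (fun f : Hom (F.obj i) c.pt => f.toHom s) (hg i)
  refine Hom.ext (OrderAddMonoidHom.ext fun s => ?_)
  obtain ⟨x, hx, hs, hxt⟩ := exists_seq_directLimit F s
  have h1 := g.map_isLUB x s (WayBelow.monotone hx) hs
  have h2 := Φ.map_isLUB x s (WayBelow.monotone hx) hs
  have h3 : ∀ n, g.toHom (x n) = Φ.toHom (x n) := fun n => by
    obtain ⟨i, t, h⟩ := hxt n
    rw [h, hg', hfac]
  simp only [h3] at h1
  exact h1.unique h2

end CuSemigroup

/-! ### Properties of arbitrary inductive limits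

The properties of the inductive limits constructed above carry over to all inductive limits. -/

section

variable {J : Type u} [Preorder J] [IsDirectedOrder J]

theorem PartOrd.exists_eq_of_isColimit {F : J ⥤ PartOrd.{u}} {d : Cocone F} (hd : IsColimit d)
    (s : d.pt) : ∃ (i : J) (t : F.obj i), (d.ι.app i).hom t = s := by
  obtain ⟨hc⟩ := isColimit_directLimitCocone F
  let e := hd.coconePointUniqueUpToIso hc
  obtain ⟨i, t, h⟩ := OrderDirectLimit.exists_mk_eq (f := mapLE F) (e.hom.hom s)
  refine ⟨i, t, ?_⟩
  have h1 := congrArg (fun f : F.obj i ⟶ d.pt => f.hom t)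
    (hd.comp_coconePointUniqueUpToIso_inv hc i)
  have h2 := congrArg (fun f : d.pt ⟶ d.pt => f.hom s) e.hom_inv_id
  exact h1.symm.trans ((congrArg e.inv.hom h).trans h2)

theorem PartOrd.exists_le_of_isColimit {F : J ⥤ PartOrd.{u}} {d : Cocone F} (hd : IsColimit d)
    {i j : J} {s : F.obj i} {t : F.obj j} (h : (d.ι.app i).hom s ≤ (d.ι.app j).hom t) :
    ∃ (k : J) (hi : i ≤ k) (hj : j ≤ k), mapLE F i k hi s ≤ mapLE F j k hj t := by
  have h1 := fun (i : J) (s : F.obj i) => congrArg (fun f : F.obj i ⟶ (directLimitCocone F).pt =>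
    f.hom s) (hd.fac (directLimitCocone F) i)
  have h2 := (hd.desc (directLimitCocone F)).hom.monotone h
  exact OrderDirectLimit.mk_le_mk.1 ((h1 i s).ge.trans (h2.trans (h1 j t).le))

/-- The homomorphism that underlies a morphism of pomonoids. -/
def PoM.hom {S T : PoM.{u}} (f : S ⟶ T) : S →+o T := f

variable [Nonempty J]

theorem PoM.exists_eq_of_isColimit {F : J ⥤ PoM.{u}} {d : Cocone F} (hd : IsColimit d)
    (s : d.pt) : ∃ (i : J) (t : F.obj i), hom (d.ι.app i) t = s := by
  obtain ⟨hc⟩ := isColimit_directLimitCocone F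
  let e := hd.coconePointUniqueUpToIso hc
  obtain ⟨i, t, h⟩ := exists_toDirectLimit_eq F (hom e.hom s)
  refine ⟨i, t, ?_⟩
  have h1 := congrArg (fun f : F.obj i →+o d.pt => f t)
    (hd.comp_coconePointUniqueUpToIso_inv hc i)
  have h2 := congrArg (fun f : d.pt →+o d.pt => f s) e.hom_inv_id
  exact h1.symm.trans ((congrArg (hom e.inv) h).trans h2)

theorem PoM.exists_le_of_isColimit {F : J ⥤ PoM.{u}} {d : Cocone F} (hd : IsColimit d)
    {i j : J} {s : F.obj i} {t : F.obj j}
    (h : hom (d.ι.app i) s ≤ hom (d.ι.app j) t) :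
    ∃ (k : J) (hi : i ≤ k) (hj : j ≤ k), mapLE F i k hi s ≤ mapLE F j k hj t := by
  have h1 := fun (i : J) (s : F.obj i) => congrArg (fun f : F.obj i →+o directLimit F => f s)
    (hd.fac (directLimitCocone F) i)
  have h2 := OrderHomClass.mono (hom (hd.desc (directLimitCocone F))) h
  exact (toDirectLimit_le_iff F).1 ((h1 i s).ge.trans (h2.trans (h1 j t).le))

theorem CuSemigroup.exists_seq_of_isColimit {F : J ⥤ CuSemigroup.{u}} {d : Cocone F}
    (hd : IsColimit d) (s : d.pt) :
    ∃ x : ℕ → d.pt, (∀ n, WayBelow (x n) (x (n + 1))) ∧ IsLUB (Set.range x) s ∧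
      ∀ n, ∃ (i : J) (t : F.obj i), x n = (d.ι.app i : Hom (F.obj i) d.pt).toHom t := by
  obtain ⟨hc⟩ := isColimit_directLimitCocone F
  let e := hd.coconePointUniqueUpToIso hc
  let f : Hom d.pt (directLimit F) := e.hom
  let g : Hom (directLimit F) d.pt := e.inv
  obtain ⟨x, hx, hs, hxt⟩ := exists_seq_directLimit F (f.toHom s)
  refine ⟨fun n => g.toHom (x n), fun n => g.map_wayBelow (hx n), ?_, fun n => ?_⟩
  · have h1 := g.map_isLUB x _ (WayBelow.monotone hx) hs
    have h2 : g.toHom (f.toHom s) = s :=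
      congrArg (fun f : Hom d.pt d.pt => f.toHom s) e.hom_inv_id
    rwa [h2] at h1
  · obtain ⟨i, t, h⟩ := hxt n
    have h1 := congrArg (fun f : Hom (F.obj i) d.pt => f.toHom t)
      (hd.comp_coconePointUniqueUpToIso_inv hc i)
    exact ⟨i, t, (congrArg g.toHom h).trans h1⟩

theorem CuSemigroup.exists_le_of_isColimit {F : J ⥤ CuSemigroup.{u}} {d : Cocone F}
    (hd : IsColimit d) {i j : J} {s : F.obj i} {t t' : F.obj j}
    (h : (d.ι.app j : Hom (F.obj j) d.pt).toHom t ≤ (d.ι.app i : Hom (F.obj i) d.pt).toHom s)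
    (ht : WayBelow t' t) : ∃ (k : J) (hj : j ≤ k) (hi : i ≤ k),
      (mapLE F j k hj).toHom t' ≤ (mapLE F i k hi).toHom s := by
  have h1 := fun (i : J) (s : F.obj i) =>
    congrArg (fun f : Hom (F.obj i) (directLimit F) => f.toHom s) (hd.fac (directLimitCocone F) i)
  have h2 := OrderHomClass.mono
    (show Hom d.pt (directLimit F) from hd.desc (directLimitCocone F)).toHom h
  exact exists_le_of_toDirectLimit_le F ((h1 j t).ge.trans (h2.trans (h1 i s).le)) ht

end

/-! ### Limit functors over posets, pomonoids and Cuntz semigroups -/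

namespace GroupSystem

variable {J : Type u} [Preorder J]

theorem isAlgebraicLimit_iff_poS [IsDirectedOrder J] {F : J ⥤ PoSGp.{u}}
    {d : Cocone (F ⋙ toBase _ _)} (hd : IsColimit d) (L : FibCocone d) :
    L.IsAlgebraicLimit ↔ L.IsKanExtension :=
  L.isAlgebraicLimit_iff (PartOrd.exists_eq_of_isColimit hd)
    fun _ _ _ _ h => PartOrd.exists_le_of_isColimit hd h

theorem isAlgebraicLimit_iff_poM [IsDirectedOrder J] [Nonempty J] {F : J ⥤ PoMGp.{u}}
    {d : Cocone (F ⋙ toBase _ _)} (hd : IsColimit d) (L : FibCocone d) :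
    L.IsAlgebraicLimit ↔ L.IsKanExtension :=
  L.isAlgebraicLimit_iff (PoM.exists_eq_of_isColimit hd)
    fun _ _ _ _ h => PoM.exists_le_of_isColimit hd h

theorem admissible_poM [Nonempty J] {F : J ⥤ PoMGp.{u}} {d : Cocone (F ⋙ toBase _ _)}
    {L : FibCocone d} (hL : L.IsAlgebraicLimit) : PoM.Admissible d.pt L.fib := by
  obtain ⟨i⟩ := ‹Nonempty J›
  let α : (F.obj i).base →+o d.pt := d.ι.app i
  have h := hL.subsingleton (i := i) (s := (0 : (F.obj i).base)) fun j hj => by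
    let β : (F.obj i).base →+o (F.obj j).base := (F.map (homOfLE hj)).base
    have h0 : push F hj (0 : (F.obj i).base) = (0 : (F.obj j).base) := map_zero β
    rw [h0]
    exact (F.obj j).property
  have h0 : app PoM.toPartOrd (d.ι.app i) (0 : (F.obj i).base) = (0 : d.pt) := map_zero α
  rw [h0] at h
  exact h

section Cuntz

variable {F : J ⥤ CuGp.{u}} {d : Cocone (F ⋙ toBase _ _)}

theorem subsingleton_zero_cu [Nonempty J] {L : FibCocone d} (hL : L.IsAlgebraicLimit) :
    Subsingleton (L.fib.obj (0 : d.pt)) := by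
  obtain ⟨i⟩ := ‹Nonempty J›
  let α : CuSemigroup.Hom (F.obj i).base d.pt := d.ι.app i
  have h := hL.subsingleton (i := i) (s := (0 : (F.obj i).base)) fun j hj => by
    let β : CuSemigroup.Hom (F.obj i).base (F.obj j).base := (F.map (homOfLE hj)).base
    have h0 : push F hj (0 : (F.obj i).base) = (0 : (F.obj j).base) := map_zero β.toHom
    rw [h0]
    exact (F.obj j).property.1
  have h0 : app CuSemigroup.toPartOrd (d.ι.app i) (0 : (F.obj i).base) = (0 : d.pt) :=
    map_zero α.toHom
  rw [h0] at h
  exact h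

/-- If `s` is the supremum of an increasing sequence `(x_n)`, then the way-below approximants of
the elements below `s` are below some `x_n`. -/
theorem dense_iUnion_below {X : ℕ ⥤ CuSemigroup.toPartOrd.obj d.pt} {c : Cocone X}
    (hc : IsLUB (Set.range X.obj) c.pt) :
    (wayBelowApproximation F).Dense (⋃ n, below d (X.obj n)) (below d c.pt) := by
  intro x hx t ht
  let α : CuSemigroup.Hom (F.obj x.idx).base d.pt := d.ι.app x.idx
  obtain ⟨n, hn⟩ := ((α.map_wayBelow ht).trans_le hx) X.obj
    (fun _ _ h => leOfHom (X.map (homOfLE h))) c.pt hc le_rfl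
  exact Set.mem_iUnion.2 ⟨n, hn⟩

/-- If `α_j∞ (t) ≤ α_i∞ (s)`, then every `t' ≪ t` is below `s` at some stage. -/
theorem dense_eventuallyBelow [IsDirectedOrder J] [Nonempty J] (hd : IsColimit d)
    (i : J) (s : CuSemigroup.toPartOrd.obj (F.obj i).base) :
    (wayBelowApproximation F).Dense (eventuallyBelow i s)
      (below d (app CuSemigroup.toPartOrd (d.ι.app i) s)) := by
  intro x hx t ht
  obtain ⟨k, hj, hi, h⟩ := CuSemigroup.exists_le_of_isColimit hd hx ht
  exact ⟨k, hi, hj, h⟩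

theorem FibCocone.IsKanExtension.preservesColimits {L : FibCocone d} (hL : L.IsKanExtension) :
    PreservesColimitsOfShape ℕ L.fib :=
  ⟨fun {_} => ⟨fun {c} hc =>
    hL.isColimit_mapCocone (dense_iUnion_below ((nonempty_isColimit_iff_isLUB c).1 ⟨hc⟩))⟩⟩

/-- For Cuntz semigroups, the completed limits are the left Kan extensions. -/
theorem isCompletedLimit_iff [IsDirectedOrder J] [Nonempty J] (hd : IsColimit d)
    (L : FibCocone d) : L.IsCompletedLimit ↔ L.IsKanExtension := by
  have key := fun (i : J) (s : CuSemigroup.toPartOrd.obj (F.obj i).base) =>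
    L.isColimit_fibCocone_iff (wayBelowApproximation F) i s (dense_eventuallyBelow hd i s)
  constructor
  · rintro ⟨hL, hseq⟩ s
    obtain ⟨x, hx, hs, hxt⟩ := CuSemigroup.exists_seq_of_isColimit hd s
    let X : ℕ ⥤ CuSemigroup.toPartOrd.obj d.pt := (WayBelow.monotone hx).functor
    let c : Cocone X := { pt := s, ι := { app := fun n => homOfLE (hs.1 ⟨n, rfl⟩) } }
    refine FibCocone.isColimit_belowCocone_of_mapCocone (c := c) (dense_iUnion_below hs)
      (fun n => ?_) (hseq X c hxt hx hs)
    obtain ⟨i, t, h⟩ := hxt n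
    have h' : X.obj n = app CuSemigroup.toPartOrd (d.ι.app i) t := h
    rw [h']
    exact (key i t).1 (hL i t)
  · intro hL
    refine ⟨fun i s => (key i s).2 (hL _), fun X c _ _ hc => ?_⟩
    exact hL.isColimit_mapCocone (dense_iUnion_below hc)

end Cuntz

end GroupSystem

theorem mainTheorem4 {J : Type u} [Preorder J] [IsDirectedOrder J] [Nonempty J] :
    -- partially ordered group systems
    (HasColimitsOfShape J PartOrd.{u} ∧ HasColimitsOfShape J PoSGp.{u} ∧
      ∀ (F : J ⥤ PoSGp.{u}) (d : Cocone (F ⋙ GroupSystem.toBase _ _)), Nonempty (IsColimit d) →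
        (∃ L : GroupSystem.FibCocone d, L.IsAlgebraicLimit) ∧
        ∀ L : GroupSystem.FibCocone d, L.IsAlgebraicLimit →
          Nonempty (IsColimit (L.toCocone trivial))) ∧
    -- pomonoid group systems
    (HasColimitsOfShape J PoM.{u} ∧ HasColimitsOfShape J PoMGp.{u} ∧
      ∀ (F : J ⥤ PoMGp.{u}) (d : Cocone (F ⋙ GroupSystem.toBase _ _)), Nonempty (IsColimit d) →
        (∃ L : GroupSystem.FibCocone d, L.IsAlgebraicLimit) ∧
        ∀ L : GroupSystem.FibCocone d, L.IsAlgebraicLimit →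
          ∃ h : PoM.Admissible d.pt L.fib, Nonempty (IsColimit (L.toCocone h))) ∧
    -- Cuntz group systems
    (HasColimitsOfShape J CuSemigroup.{u} ∧ HasColimitsOfShape J CuGp.{u} ∧
      ∀ (F : J ⥤ CuGp.{u}) (d : Cocone (F ⋙ GroupSystem.toBase _ _)), Nonempty (IsColimit d) →
        (∃ L : GroupSystem.FibCocone d, L.IsCompletedLimit) ∧
        ∀ L : GroupSystem.FibCocone d, L.IsCompletedLimit →
          ∃ h : CuSemigroup.Admissible d.pt L.fib, Nonempty (IsColimit (L.toCocone h))) := by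

  have hPoS : ∀ (F : J ⥤ PoSGp.{u}) (d : Cocone (F ⋙ GroupSystem.toBase _ _)),
      Nonempty (IsColimit d) → (∃ L : GroupSystem.FibCocone d, L.IsAlgebraicLimit) ∧
        ∀ L : GroupSystem.FibCocone d, L.IsAlgebraicLimit →
          Nonempty (IsColimit (L.toCocone trivial)) := by
    rintro F d ⟨hd⟩
    refine ⟨?_, fun L hL => ?_⟩
    · obtain ⟨L, hL⟩ := GroupSystem.FibCocone.exists_isKanExtension d
      exact ⟨L, (GroupSystem.isAlgebraicLimit_iff_poS hd L).2 hL⟩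
    · exact ((GroupSystem.isAlgebraicLimit_iff_poS hd L).1 hL).isColimit_toCocone hd trivial
  have hPoM : ∀ (F : J ⥤ PoMGp.{u}) (d : Cocone (F ⋙ GroupSystem.toBase _ _)),
      Nonempty (IsColimit d) → (∃ L : GroupSystem.FibCocone d, L.IsAlgebraicLimit) ∧
        ∀ L : GroupSystem.FibCocone d, L.IsAlgebraicLimit →
          ∃ h : PoM.Admissible d.pt L.fib, Nonempty (IsColimit (L.toCocone h)) := by
    rintro F d ⟨hd⟩
    refine ⟨?_, fun L hL => ?_⟩
    · obtain ⟨L, hL⟩ := GroupSystem.FibCocone.exists_isKanExtension d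
      exact ⟨L, (GroupSystem.isAlgebraicLimit_iff_poM hd L).2 hL⟩
    · exact ⟨GroupSystem.admissible_poM hL,
        ((GroupSystem.isAlgebraicLimit_iff_poM hd L).1 hL).isColimit_toCocone hd _⟩
  have hCu : ∀ (F : J ⥤ CuGp.{u}) (d : Cocone (F ⋙ GroupSystem.toBase _ _)),
      Nonempty (IsColimit d) → (∃ L : GroupSystem.FibCocone d, L.IsCompletedLimit) ∧
        ∀ L : GroupSystem.FibCocone d, L.IsCompletedLimit →
          ∃ h : CuSemigroup.Admissible d.pt L.fib, Nonempty (IsColimit (L.toCocone h)) := by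
    rintro F d ⟨hd⟩
    refine ⟨?_, fun L hL => ?_⟩
    · obtain ⟨L, hL⟩ := GroupSystem.FibCocone.exists_isKanExtension d
      exact ⟨L, (GroupSystem.isCompletedLimit_iff hd L).2 hL⟩
    · have hK := (GroupSystem.isCompletedLimit_iff hd L).1 hL
      exact ⟨⟨GroupSystem.subsingleton_zero_cu hL.1, hK.preservesColimits⟩,
        hK.isColimit_toCocone hd _⟩
  have h1 : HasColimitsOfShape J PartOrd.{u} :=
    ⟨fun F => ⟨⟨⟨_, (PartOrd.isColimit_directLimitCocone F).some⟩⟩⟩⟩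
  have h2 : HasColimitsOfShape J PoM.{u} :=
    ⟨fun F => ⟨⟨⟨_, (PoM.isColimit_directLimitCocone F).some⟩⟩⟩⟩
  have h3 : HasColimitsOfShape J CuSemigroup.{u} :=
    ⟨fun F => ⟨⟨⟨_, (CuSemigroup.isColimit_directLimitCocone F).some⟩⟩⟩⟩
  refine ⟨⟨h1, ⟨fun F => ?_⟩, hPoS⟩, ⟨h2, ⟨fun F => ?_⟩, hPoM⟩, ⟨h3, ⟨fun F => ?_⟩, hCu⟩⟩
  · obtain ⟨⟨L, hL⟩, h⟩ := hPoS F _ ⟨colimit.isColimit _⟩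
    exact ⟨⟨⟨_, (h L hL).some⟩⟩⟩
  · obtain ⟨⟨L, hL⟩, h⟩ := hPoM F _ ⟨colimit.isColimit _⟩
    obtain ⟨_, ⟨hc⟩⟩ := h L hL
    exact ⟨⟨⟨_, hc⟩⟩⟩
  · obtain ⟨⟨L, hL⟩, h⟩ := hCu F _ ⟨colimit.isColimit _⟩
    obtain ⟨_, ⟨hc⟩⟩ := h L hL
    exact ⟨⟨⟨_, hc⟩⟩⟩
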